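/- A lazy shortest-path problem consists of a finite directed graph $G=(V,E)$, two distinct vertices $v_{\mathrm{source}},v_{\mathrm{target}}$, positive lazy edge weights $\hat w:E\to\mathbb R_{>0}$ and true weights $w$ with $w(e)=\hat w(e)$ if $e$ is collision-free and $w(e)=\infty$ if $e$ is in collision. Initially no edge has been evaluated; evaluating $e$ reveals $w(e)$. For integers $\alpha\ge\beta\ge 1$, the algorithm LRA* with lookahead $\alpha$ and greediness $\beta$ maintains a search tree $T$ rooted at $v_{\mathrm{source}}$, with at most one node per vertex. The tree path to each vertex is the concatenation of an evaluated, collision-free head and a tail of edges that have not been evaluated; the number of edges in the tail is the budget of the vertex, and its key is the true cost of the head plus the lazy cost of the tail. A vertex of budget $\alpha$, or the target, is a frontier vertex and is not extended; every other vertex of $T$ that is a leaf is extended to its successors in the graph, in order of increasing keys, a vertex receiving a new parent whenever this does not increase its key (the subtree below it is then discarded and rebuilt by extension). When no more extension is possible, LRA* takes a frontier vertex of minimal key and evaluates, in order, the first $\beta$ edges of the tail of its tree path (all of them if there are fewer than $\beta$), stopping at the first edge found to be in collision. If $v_{\mathrm{target}}$ is reached by a collision-free edge, the algorithm terminates. Otherwise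 the edges found to be collision-free join the head and the keys and budgets below them are updated; an edge found to be in collision is deleted from the graph, and the vertices of the subtree below it are reattached, in order of increasing keys, to the best available parents in $T$ that are different from $v_{\mathrm{target}}$ and have budget less than $\alpha$, or leave $T$ if there are none. Then the tree is extended again, and so on. The algorithm also terminates when there is no frontier vertex left. Let $E_\beta$ denote the set of edges evaluated by LRA* with lookahead $\alpha$ and greediness $\beta$. **Lemma.** For all integers $\alpha,\beta_1,\beta_2$ with $\alpha\ge\beta_2>\beta_1>1$ there is a lazy shortest-path problem, in which no two different paths (with at least one edge each) have the same lazy cost, such that $$E_{\beta_1}\setminus E_{\beta_2}\neq\emptyset ,$$ for every rule by which the algorithm breaks ties between equal keys. -/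

import Mathlib

/-- A lazy shortest-path problem on a directed graph with vertex type `V`: edges `adj`, lazy
estimate `lazyW` of the edge weights (positive reals), true weights `w`, source and target.
The true weight of an edge is its lazy estimate if the edge is collision-free and infinite
if the edge is in collision. The values of `lazyW` and `w` off the edges are irrelevant. -/
structure LazyProblem (V : Type) where
  adj : V → V → Prop
  lazyW : V → V → ℝ
  w : V → V → WithTop ℝ
  source : V
  target : V
  lazyW_pos : ∀ u v, adj u v → 0 < lazyW u v
  w_eq : ∀ u v, adj u v → w u v = (lazyW u v : WithTop ℝ) ∨ w u v = ⊤
  source_ne_target : source ≠ target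

/-- The lazy cost of a path given as its sequence of vertices. -/
def LazyProblem.lazyCost {V : Type} (G : LazyProblem V) (p : List V) : ℝ :=
  ((p.zip p.tail).map fun e => G.lazyW e.1 e.2).sum

/-- No two different paths of the graph (sequences of at least two vertices in which consecutive
vertices are joined by an edge) have the same lazy cost. -/
def LazyProblem.DistinctPathCosts {V : Type} (G : LazyProblem V) : Prop :=
  ∀ p q : List V, p.IsChain G.adj → q.IsChain G.adj → 2 ≤ p.length → 2 ≤ q.length →
    G.lazyCost p = G.lazyCost q → p = q

/-- The rule by which a priority queue returns an element of minimal key; the rule decides how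
ties between elements with the same key are broken. -/
structure PopRule (V : Type) where
  pick : Set V → (V → WithTop ℝ) → V
  pick_mem : ∀ (Q : Set V) (k : V → WithTop ℝ), Q.Nonempty → pick Q k ∈ Q
  pick_le : ∀ (Q : Set V) (k : V → WithTop ℝ), ∀ x ∈ Q, k (pick Q k) ≤ k x

/-- Pop rules exist on every finite nonempty vertex set. -/
theorem PopRule.nonempty (V : Type) [Finite V] [Nonempty V] : Nonempty (PopRule V) := by
  classical
  have h : ∀ (Q : Set V) (k : V → WithTop ℝ), ∃ v : V,
      (Q.Nonempty → v ∈ Q) ∧ ∀ x ∈ Q, k v ≤ k x := by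
    intro Q k
    by_cases hQ : Q.Nonempty
    · obtain ⟨v, hv, hmin⟩ := Set.exists_min_image Q k Q.toFinite hQ
      exact ⟨v, fun _ => hv, hmin⟩
    · exact ⟨Classical.arbitrary V, fun h => absurd h hQ, fun x hx => absurd ⟨x, hx⟩ hQ⟩
  choose f hf using h
  exact ⟨⟨f, fun Q k => (hf Q k).1, fun Q k => (hf Q k).2⟩⟩

/-- The data stored with a vertex in the search tree: its parent (`none` for NIL), the cost `c`
of the evaluated part of the tree path to it, the lazy cost `l` of the part that is only lazily
evaluated, and the budget `b`, the number of edges in the latter part. -/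
structure TreeNode (V : Type) where
  parent : Option V
  c : ℝ
  l : ℝ
  b : ℕ

/-- The key `c + l` of a node; a vertex without a node has infinite key. -/
def nodeKey {V : Type} : Option (TreeNode V) → WithTop ℝ
  | none => ⊤
  | some t => ((t.c + t.l : ℝ) : WithTop ℝ)

/-- The memory of the algorithm. `tree v` is the node of `v` if `v` is in the search tree, and
`tent v` is the tentative node of a vertex `v` that waits in `qRewire`. -/
structure LRAState (V : Type) where
  tree : V → Option (TreeNode V)
  tent : V → Option (TreeNode V)
  edges : V → V → Prop
  qUpdate : Set V
  toRewire : Set V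
  qRewire : Set V
  qExtend : Set V
  qFrontier : Set V
  evaluated : Set (V × V)
  halted : Prop

/-- `s.IsChild u v`: the vertex `v` is in the search tree and its parent there is `u`. -/
def LRAState.IsChild {V : Type} (s : LRAState V) (u v : V) : Prop :=
  ∃ t, s.tree v = some t ∧ t.parent = some u

/-- The vertices of the subtree of the search tree that is rooted at `v`. -/
def LRAState.subtree {V : Type} (s : LRAState V) (v : V) : Set V :=
  {x | s.tree x ≠ none ∧ Relation.ReflTransGen s.IsChild v x}

/-- The last `n + 1` vertices on the tree path that ends in `v`; for `n` the budget of `v` these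
are the vertices of the lazily evaluated tail of that path, starting with its border vertex. -/
def LRAState.tail {V : Type} (s : LRAState V) : ℕ → V → List V
  | 0, v => [v]
  | n + 1, v =>
    match (s.tree v).bind TreeNode.parent with
    | none => [v]
    | some u => s.tail n u ++ [v]

namespace LazyProblem

variable {V : Type}

/-- The node of `v` as a child of `u` with node `t`, the edge `(u, v)` not being evaluated. -/
def childNode (G : LazyProblem V) (u : V) (t : TreeNode V) (v : V) : TreeNode V :=
  ⟨some u, t.c, t.l + G.lazyW u v, t.b + 1⟩

open Classical in
/-- Only the source is in the search tree, and it waits to be extended. -/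
noncomputable def initState (G : LazyProblem V) : LRAState V where
  tree v := if v = G.source then some ⟨none, 0, 0, 0⟩ else none
  tent _ := none
  edges := G.adj
  qUpdate := ∅
  toRewire := ∅
  qRewire := ∅
  qExtend := {G.source}
  qFrontier := ∅
  evaluated := ∅
  halted := False

open Classical in
/-- Evaluate up to `n` edges along the given path, in order, stopping early at the first edge in
collision, when the target is reached, or at the end of the path. A collision-free edge moves its
end vertex to the evaluated part of the tree; an edge in collision is removed from the graph, and
the subtree below it has to be rewired. -/
noncomputable def evaluatePath (G : LazyProblem V) :
    ℕ → List V → LRAState V → LRAState V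
  | n + 1, u :: v :: p, s =>
    if G.w u v = (G.lazyW u v : WithTop ℝ) then
      let cu : ℝ := ((s.tree u).map TreeNode.c).getD 0
      let s' : LRAState V :=
        { s with
          tree := fun x => if x = v then some ⟨some u, cu + G.lazyW u v, 0, 0⟩ else s.tree x
          qUpdate := insert v s.qUpdate
          evaluated := insert (u, v) s.evaluated }
      if v = G.target then { s' with halted := True }
      else G.evaluatePath n (v :: p) s'
    else
      { s with
        edges := fun x y => s.edges x y ∧ (x, y) ≠ (u, v)
        toRewire := s.subtree v
        evaluated := insert (u, v) s.evaluated }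
  | _, _, s => s

/-- Take a frontier vertex of minimal key and evaluate the first `β` edges along the tail of its
tree path. -/
noncomputable def searchStep (G : LazyProblem V) (R : PopRule V) (β : ℕ) (s : LRAState V) :
    LRAState V :=
  let v := R.pick s.qFrontier fun x => nodeKey (s.tree x)
  let b : ℕ := ((s.tree v).map TreeNode.b).getD 0
  G.evaluatePath β (s.tail b v) { s with qFrontier := s.qFrontier \ {v} }

open Classical in
/-- One iteration of the update loop: propagate the new data of a vertex to its children in the
tree. Children that have been evaluated themselves (budget `0`) or whose subtree has to be rewired
are not touched. -/
noncomputable def updateStep (G : LazyProblem V) (R : PopRule V) (α : ℕ) (s : LRAState V) :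
    LRAState V :=
  let u := R.pick s.qUpdate fun x => nodeKey (s.tree x)
  let q := s.qUpdate \ {u}
  match s.tree u with
  | none => { s with qUpdate := q }
  | some t =>
    if ∃ v, s.IsChild u v then
      let ch : Set V := {v | ∃ t', s.tree v = some t' ∧ t'.parent = some u ∧ 0 < t'.b ∧
        v ∉ s.toRewire}
      { s with
        tree := fun v => if v ∈ ch then some (G.childNode u t v) else s.tree v
        qFrontier := s.qFrontier \ {v | v ∈ ch ∧ ∃ t', s.tree v = some t' ∧ t'.b = α}
        qUpdate := q ∪ ch }
    else { s with qUpdate := q, qExtend := insert u s.qExtend }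

open Classical in
/-- Remove all vertices that have to be rewired from the tree and from the frontier, and compute
for each of them the best parent outside of the removed set, if there is one. -/
noncomputable def startRewire (G : LazyProblem V) (R : PopRule V) (α : ℕ) (s : LRAState V) :
    LRAState V :=
  let parents : V → Set V := fun v => {u | u ∉ s.toRewire ∧ u ∉ s.qExtend ∧ u ≠ G.target ∧
    s.edges u v ∧ ∃ t, s.tree u = some t ∧ t.b < α}
  let best : V → V := fun v =>
    R.pick (parents v) fun u => nodeKey (s.tree u) + (G.lazyW u v : WithTop ℝ)
  { s with
    tree := fun v => if v ∈ s.toRewire then none else s.tree v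
    tent := fun v =>
      if v ∈ s.toRewire ∧ (parents v).Nonempty then
        (s.tree (best v)).map fun t => G.childNode (best v) t v
      else none
    qFrontier := s.qFrontier \ s.toRewire
    qRewire := s.toRewire
    toRewire := ∅ }

open Classical in
/-- One iteration of the rewiring loop: put a vertex with its best parent into the tree, and offer
it as a parent to the vertices that still wait to be rewired. -/
noncomputable def rewireStep (G : LazyProblem V) (R : PopRule V) (α : ℕ) (s : LRAState V) :
    LRAState V :=
  let u := R.pick s.qRewire fun x => nodeKey (s.tent x)
  let q := s.qRewire \ {u}
  match s.tent u with
  | none => { s with qRewire := q }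
  | some t =>
    let s' : LRAState V :=
      { s with
        tree := fun x => if x = u then some t else s.tree x
        qRewire := q }
    if t.b = α ∨ u = G.target then { s' with qFrontier := insert u s.qFrontier }
    else
      { s' with
        qExtend := insert u s.qExtend
        tent := fun v =>
          if s.edges u v ∧ v ∈ q ∧ nodeKey (some (G.childNode u t v)) < nodeKey (s.tent v) then
            some (G.childNode u t v)
          else s.tent v }

open Classical in
/-- One iteration of the loop that extends the band. The target is not extended but made a
frontier vertex. Otherwise the successors of the vertex to which the path through it is at least
as good as their current tree path are removed from the tree together with their subtrees, and all
successors that are not in the tree now become children of the vertex. -/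
noncomputable def extendStep (G : LazyProblem V) (R : PopRule V) (α : ℕ) (s : LRAState V) :
    LRAState V :=
  let u := R.pick s.qExtend fun x => nodeKey (s.tree x)
  let q := s.qExtend \ {u}
  match s.tree u with
  | none => { s with qExtend := q }
  | some t =>
    if u = G.target then { s with qExtend := q, qFrontier := insert u s.qFrontier }
    else
      let cut : Set V := {x | ∃ v, s.edges u v ∧
        nodeKey (some (G.childNode u t v)) ≤ nodeKey (s.tree v) ∧ x ∈ s.subtree v}
      let new : Set V := {v | s.edges u v ∧ (v ∈ cut ∨ s.tree v = none)}
      { s with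
        tree := fun x =>
          if x ∈ new then some (G.childNode u t x) else if x ∈ cut then none else s.tree x
        qFrontier := (s.qFrontier \ cut) ∪ {v | v ∈ new ∧ t.b + 1 = α}
        qExtend := (q \ cut) ∪ {v | v ∈ new ∧ t.b + 1 ≠ α} }

open Classical in
/-- One step of LRA* with lookahead `α` and greediness `β`. After every evaluation of edges the
search tree is first updated, then rewired, then extended, and when that is finished the next
frontier vertex is chosen. The algorithm stops when the target has been reached by collision-free
edges, or when the frontier is empty. -/
noncomputable def lraStep (G : LazyProblem V) (R : PopRule V) (α β : ℕ) (s : LRAState V) :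
    LRAState V :=
  if s.halted then s
  else if s.qUpdate.Nonempty then G.updateStep R α s
  else if s.toRewire.Nonempty then G.startRewire R α s
  else if s.qRewire.Nonempty then G.rewireStep R α s
  else if s.qExtend.Nonempty then G.extendStep R α s
  else if s.qFrontier.Nonempty then G.searchStep R β s
  else s

/-- The set of edges that LRA* with lookahead `α` and greediness `β` evaluates. -/
def evaluatedEdges (G : LazyProblem V) (R : PopRule V) (α β : ℕ) : Set (V × V) :=
  {e | ∃ n : ℕ, e ∈ ((G.lraStep R α β)^[n] G.initState).evaluated}

end LazyProblem

/-!
The witness is a collision-free tree: a path `0, 1, …, α`, a branch of `α - 1` vertices that leaves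
it at `β₁ + 1`, and an edge from the source `0` to the target that is more expensive than all the
rest. The end `α` of the path is the only cheap vertex that first gets the budget `α`, so the first
`β` edges of the path are evaluated. If `β = β₁`, the vertex `β₁ + 1` keeps the budget `1`, the end
of the branch gets the budget `α`, and it is chosen before the target: this evaluates the first
edge of the branch, because `1 < β₁`. If `β > β₁`, the vertex `β₁ + 1` gets the budget `0`, all
budgets outside of the target's edge stay below `α`, and the target is reached without an
evaluation on the branch. Giving the edge into the vertex `v` the weight `2 ^ v` makes the costs of
paths distinct, by uniqueness of binary expansions, and orders the keys by the labels, so that no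
tie is ever broken between frontier vertices.
-/

namespace LazyProblem

variable {V : Type} {G : LazyProblem V} {α β : ℕ} {par : V → V} {dist : V → ℝ} {bud bud' : V → ℕ}
  {s : LRAState V} {u v x : V}

/-- The edges of `G` form a tree with root `G.source` and parent map `par`, they are all
collision-free, and the target is a leaf. The function `dist` is the lazy cost of the path from the
source; it increases along the edges, which rules out cycles. -/
structure IsFreeTree (G : LazyProblem V) (par : V → V) (dist : V → ℝ) : Prop where
  adj_iff : ∀ u v, G.adj u v ↔ v ≠ G.source ∧ u = par v
  w_eq_lazyW : ∀ u v, G.adj u v → G.w u v = (G.lazyW u v : WithTop ℝ)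
  dist_source : dist G.source = 0
  dist_eq_add : ∀ u v, G.adj u v → dist v = dist u + G.lazyW u v
  not_adj_target : ∀ v, ¬ G.adj G.target v

/-- `bud v` is the number of edges that lead from the last vertex with `bud = 0` on the tree path
to `v` on to `v`: the budget of `v` when exactly the edges into the vertices with `bud = 0` have
been evaluated. -/
structure IsBudget (G : LazyProblem V) (bud : V → ℕ) : Prop where
  source : bud G.source = 0
  eq_succ : ∀ u v, G.adj u v → bud v ≠ 0 → bud v = bud u + 1

/-- The tree of a state of LRA* is a subtree of the graph `G`, a tree with parent map `par`,
whose nodes have the right parents and keys. -/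
structure IsSearchTree (G : LazyProblem V) (par : V → V) (dist : V → ℝ)
    (T : V → Option (TreeNode V)) : Prop where
  source : T G.source = some ⟨none, 0, 0, 0⟩
  parent_eq : ∀ v t, v ≠ G.source → T v = some t → t.parent = some (par v)
  key_eq : ∀ v t, T v = some t → t.c + t.l = dist v
  mem_of_adj : ∀ u v, G.adj u v → T v ≠ none → T u ≠ none

/-- The tree `T` after the vertices of `S` have received the nodes given by `f`. -/
noncomputable def overwrite (T : V → Option (TreeNode V)) (S : Set V) (f : V → TreeNode V) :
    V → Option (TreeNode V) :=
  open Classical in fun x => if x ∈ S then some (f x) else T x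

/-- The budget stored with a vertex in the search tree `T`, and `0` for a vertex outside of it. -/
def budget (T : V → Option (TreeNode V)) (v : V) : ℕ :=
  ((T v).map TreeNode.b).getD 0

/-- The invariant of the update and extension phases of LRA* on a collision-free tree, the edges
into the vertices with `bud = 0` having been evaluated. The stored budgets are too large below the
vertices in `qUpdate`, and agree with `bud` once this queue is empty. -/
structure IsBand (G : LazyProblem V) (α : ℕ) (par : V → V) (dist : V → ℝ) (bud : V → ℕ)
    (s : LRAState V) : Prop extends IsSearchTree G par dist s.tree where
  not_halted : ¬ s.halted
  edges_eq : s.edges = G.adj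
  toRewire_eq : s.toRewire = ∅
  qRewire_eq : s.qRewire = ∅
  evaluated_eq : s.evaluated = {e | G.adj e.1 e.2 ∧ bud e.2 = 0}
  head : ∀ v, bud v = 0 → ∃ p, s.tree v = some ⟨p, dist v, 0, 0⟩
  sibling_mem : ∀ u v v', G.adj u v → G.adj u v' → s.tree v ≠ none → s.tree v' ≠ none
  budget_le : ∀ v, budget s.tree v ≤ α
  budget_eq_succ : ∀ u v, G.adj u v → s.tree v ≠ none → bud v ≠ 0 → u ∉ s.qUpdate →
    budget s.tree v = budget s.tree u + 1
  succ_lt_budget : ∀ u v, G.adj u v → s.tree v ≠ none → bud v ≠ 0 → u ∈ s.qUpdate →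
    budget s.tree u + 1 < budget s.tree v
  queued : ∀ v ∈ s.qUpdate ∪ s.qExtend, s.tree v ≠ none ∧ budget s.tree v < α
  leaf : ∀ u v, G.adj u v → s.tree v ≠ none → u ∉ s.qExtend
  extended : ∀ u v, G.adj u v → s.tree u ≠ none → budget s.tree u < α → s.tree v = none →
    u ∈ s.qUpdate ∪ s.qExtend
  frontier : ∀ v ∈ s.qFrontier, s.tree v ≠ none ∧ (budget s.tree v = α ∨ v = G.target)
  mem_frontier : ∀ v, s.tree v ≠ none → bud v = α → v ∈ s.qFrontier
  target_queued : s.tree G.target ≠ none → G.target ∈ s.qFrontier ∪ (s.qUpdate ∪ s.qExtend)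

/-- A state of LRA* on a collision-free tree in which the next frontier vertex is chosen. -/
structure IsSettled (G : LazyProblem V) (α : ℕ) (par : V → V) (dist : V → ℝ) (bud : V → ℕ)
    (s : LRAState V) : Prop extends IsBand G α par dist bud s where
  qUpdate_eq : s.qUpdate = ∅
  qExtend_eq : s.qExtend = ∅

theorem IsFreeTree.adj_par (hG : G.IsFreeTree par dist) (hv : v ≠ G.source) : G.adj (par v) v :=
  (hG.adj_iff _ _).2 ⟨hv, rfl⟩

theorem IsFreeTree.eq_of_adj (hG : G.IsFreeTree par dist) {u' : V} (h : G.adj u v)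
    (h' : G.adj u' v) : u = u' :=
  ((hG.adj_iff _ _).1 h).2.trans ((hG.adj_iff _ _).1 h').2.symm

theorem IsFreeTree.dist_lt (hG : G.IsFreeTree par dist) (h : G.adj u v) : dist u < dist v := by
  rw [hG.dist_eq_add u v h]
  exact lt_add_of_pos_right _ (G.lazyW_pos u v h)

theorem IsBudget.ne_source (hb : G.IsBudget bud) (hv : bud v ≠ 0) : v ≠ G.source := by
  rintro rfl
  exact hv hb.source

theorem IsBudget.adj_par (hb : G.IsBudget bud) (hG : G.IsFreeTree par dist) (hv : bud v ≠ 0) :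
    G.adj (par v) v :=
  hG.adj_par (hb.ne_source hv)

theorem IsBudget.iterate_par (hb : G.IsBudget bud) (hG : G.IsFreeTree par dist) (v : V) {k : ℕ}
    (hk : k ≤ bud v) : bud (par^[k] v) = bud v - k := by
  induction k with
  | zero => rfl
  | succ k ih =>
    have ih := ih (by omega)
    have := hb.eq_succ _ _ (hb.adj_par hG (v := par^[k] v) (by omega)) (by omega)
    rw [Function.iterate_succ_apply']
    omega

theorem IsBudget.iterate_par_ne_source (hb : G.IsBudget bud) (hG : G.IsFreeTree par dist) {k : ℕ}
    (hk : k < bud v) : par^[k] v ≠ G.source := by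
  refine hb.ne_source ?_
  rw [hb.iterate_par hG v hk.le]
  omega

theorem IsBudget.le_add_iterate_par (hb : G.IsBudget bud) (hG : G.IsFreeTree par dist) (v : V)
    (k : ℕ) : bud v ≤ bud (par^[k] v) + k := by
  rcases le_total k (bud v) with hk | hk
  · rw [hb.iterate_par hG v hk]
    omega
  · omega

theorem IsBudget.mono (hb : G.IsBudget bud) (hb' : G.IsBudget bud') (hG : G.IsFreeTree par dist)
    (h : ∀ v, bud v = 0 → bud' v = 0) (v : V) : bud' v ≤ bud v := by
  have hk := hb.iterate_par hG v le_rfl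
  have := h _ (hk.trans (Nat.sub_self _))
  have := hb'.le_add_iterate_par hG v (bud v)
  omega

theorem IsSearchTree.isChild_iff (h : IsSearchTree G par dist s.tree)
    (hG : G.IsFreeTree par dist) : s.IsChild u v ↔ G.adj u v ∧ s.tree v ≠ none := by
  rw [hG.adj_iff]
  constructor
  · rintro ⟨t, ht, hp⟩
    have hv : v ≠ G.source := by
      rintro rfl
      cases h.source.symm.trans ht
      cases hp
    exact ⟨⟨hv, Option.some.inj (hp.symm.trans (h.parent_eq v t hv ht))⟩, by simp [ht]⟩
  · rintro ⟨⟨hv, rfl⟩, ht⟩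
    obtain ⟨t, ht⟩ := Option.ne_none_iff_exists'.1 ht
    exact ⟨t, ht, h.parent_eq v t hv ht⟩

theorem IsSearchTree.nodeKey_eq (h : IsSearchTree G par dist s.tree) (hv : s.tree v ≠ none) :
    nodeKey (s.tree v) = (dist v : WithTop ℝ) := by
  obtain ⟨t, ht⟩ := Option.ne_none_iff_exists'.1 hv
  rw [ht, ← h.key_eq v t ht, nodeKey]

theorem IsSearchTree.subtree_eq_empty (h : IsSearchTree G par dist s.tree)
    (hG : G.IsFreeTree par dist) (hv : s.tree v = none) : s.subtree v = ∅ := by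
  refine Set.eq_empty_of_forall_notMem ?_
  rintro x ⟨hx, hvx⟩
  rcases hvx.cases_head with rfl | ⟨y, hvy, -⟩
  · exact hx hv
  · obtain ⟨hadj, hy⟩ := (h.isChild_iff hG).1 hvy
    exact h.mem_of_adj _ _ hadj hy hv

section overwrite

variable {T : V → Option (TreeNode V)} {S S' : Set V} {f : V → TreeNode V}

theorem overwrite_of_mem (hx : x ∈ S) : overwrite T S f x = some (f x) := if_pos hx

theorem overwrite_of_notMem (hx : x ∉ S) : overwrite T S f x = T x := if_neg hx

theorem ite_eq_overwrite {_ : DecidablePred (· ∈ S)} :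
    (fun x => if x ∈ S then some (f x) else T x) = overwrite T S f := by
  funext x
  by_cases hx : x ∈ S <;> simp [overwrite, hx]

theorem overwrite_ne_none_iff : overwrite T S f x ≠ none ↔ x ∈ S ∨ T x ≠ none := by
  by_cases hx : x ∈ S
  · simp [overwrite_of_mem hx, hx]
  · simp [overwrite_of_notMem hx, hx]

theorem overwrite_ne_none_iff_of_subset (hS : ∀ y ∈ S, T y ≠ none) :
    overwrite T S f x ≠ none ↔ T x ≠ none := by
  rw [overwrite_ne_none_iff, or_iff_right_of_imp (hS x)]

theorem budget_of_eq_some {t : TreeNode V} (h : T x = some t) : budget T x = t.b := by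
  simp [budget, h]

theorem budget_overwrite_of_mem (hx : x ∈ S) : budget (overwrite T S f) x = (f x).b :=
  budget_of_eq_some (overwrite_of_mem hx)

theorem budget_overwrite_of_notMem (hx : x ∉ S) : budget (overwrite T S f) x = budget T x := by
  rw [budget, overwrite_of_notMem hx, budget]

theorem overwrite_overwrite :
    overwrite (overwrite T S f) S' f = overwrite T (S ∪ S') f := by
  funext x
  by_cases hS : x ∈ S <;> by_cases hS' : x ∈ S' <;> simp [overwrite, hS, hS']

theorem IsSearchTree.overwrite (h : IsSearchTree G par dist T)
    (hS : ∀ v ∈ S, ∃ u, G.adj u v ∧ T u ≠ none) (hsource : G.source ∉ S)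
    (hparent : ∀ v ∈ S, (f v).parent = some (par v))
    (hkey : ∀ v ∈ S, (f v).c + (f v).l = dist v) (hG : G.IsFreeTree par dist) :
    IsSearchTree G par dist (overwrite T S f) where
  source := (overwrite_of_notMem hsource).trans h.source
  parent_eq v t hv ht := by
    by_cases hvS : v ∈ S
    · cases (overwrite_of_mem hvS).symm.trans ht
      exact hparent v hvS
    · exact h.parent_eq v t hv ((overwrite_of_notMem hvS).symm.trans ht)
  key_eq v t ht := by
    by_cases hvS : v ∈ S
    · cases (overwrite_of_mem hvS).symm.trans ht
      exact hkey v hvS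
    · exact h.key_eq v t ((overwrite_of_notMem hvS).symm.trans ht)
  mem_of_adj u v huv hv := by
    refine overwrite_ne_none_iff.2 (Or.inr ?_)
    rcases overwrite_ne_none_iff.1 hv with hvS | hv
    · obtain ⟨u', hu'v, hu'⟩ := hS v hvS
      rwa [hG.eq_of_adj huv hu'v]
    · exact h.mem_of_adj u v huv hv

end overwrite

/-- The children of `u` in the tree `G` whose edge to `u` has not been evaluated. -/
def lazyChildren (G : LazyProblem V) (bud : V → ℕ) (u : V) : Set V :=
  {v | G.adj u v ∧ bud v ≠ 0}

/-- The state `s` after the data of the vertex `u` with node `t` have been propagated to its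
children. -/
noncomputable def propagate (G : LazyProblem V) (α : ℕ) (bud : V → ℕ) (s : LRAState V) (u : V)
    (t : TreeNode V) : LRAState V :=
  { s with
    tree := overwrite s.tree (G.lazyChildren bud u) (G.childNode u t)
    qFrontier := s.qFrontier \ {v | v ∈ G.lazyChildren bud u ∧ budget s.tree v = α}
    qUpdate := (s.qUpdate \ {u}) ∪ G.lazyChildren bud u }

namespace IsBand

theorem succ_le_budget (h : G.IsBand α par dist bud s) (huv : G.adj u v) (hv : s.tree v ≠ none)
    (hbv : bud v ≠ 0) : budget s.tree u + 1 ≤ budget s.tree v := by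
  by_cases hu : u ∈ s.qUpdate
  · exact (h.succ_lt_budget u v huv hv hbv hu).le
  · exact (h.budget_eq_succ u v huv hv hbv hu).ge

theorem bud_le_budget (h : G.IsBand α par dist bud s) (hG : G.IsFreeTree par dist)
    (hb : G.IsBudget bud) (hv : s.tree v ≠ none) : bud v ≤ budget s.tree v := by
  induction hn : bud v generalizing v with
  | zero => exact Nat.zero_le _
  | succ n ih =>
    have hbv : bud v ≠ 0 := by omega
    have hadj := hb.adj_par hG hbv
    have := hb.eq_succ _ _ hadj hbv
    exact (Nat.succ_le_succ (ih (h.mem_of_adj _ _ hadj hv) (by omega))).trans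
      (h.succ_le_budget hadj hv hbv)

theorem budget_pos_iff (h : G.IsBand α par dist bud s) (hG : G.IsFreeTree par dist)
    (hb : G.IsBudget bud) (hv : s.tree v ≠ none) : 0 < budget s.tree v ↔ bud v ≠ 0 := by
  refine ⟨fun hpos h0 => ?_, fun h0 => (Nat.pos_of_ne_zero h0).trans_le (h.bud_le_budget hG hb hv)⟩
  obtain ⟨p, hp⟩ := h.head v h0
  exact hpos.ne' (budget_of_eq_some hp)

theorem updateStep_of_forall_tree_eq_none (h : G.IsBand α par dist bud s)
    (hG : G.IsFreeTree par dist) (R : PopRule V)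
    (hu : R.pick s.qUpdate (fun x => nodeKey (s.tree x)) = u) (hu' : s.tree u ≠ none)
    (hleaf : ∀ v, G.adj u v → s.tree v = none) :
    G.updateStep R α s =
      { s with qUpdate := s.qUpdate \ {u}, qExtend := insert u s.qExtend } := by
  obtain ⟨t, ht⟩ := Option.ne_none_iff_exists'.1 hu'
  have hchild : ¬ ∃ v, s.IsChild u v := by
    rintro ⟨v, hv⟩
    obtain ⟨hadj, hv⟩ := (h.isChild_iff hG).1 hv
    exact hv (hleaf v hadj)
  subst hu
  simp only [updateStep, ht, if_neg hchild]

theorem moveToExtend (h : G.IsBand α par dist bud s) (hu : u ∈ s.qUpdate)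
    (hleaf : ∀ v, G.adj u v → s.tree v = none) :
    G.IsBand α par dist bud
      { s with qUpdate := s.qUpdate \ {u}, qExtend := insert u s.qExtend } where
  __ := h
  budget_eq_succ a v hav hv hbv ha := by
    refine h.budget_eq_succ a v hav hv hbv fun ha' => ha ⟨ha', ?_⟩
    rintro rfl
    exact hv (hleaf v hav)
  succ_lt_budget a v hav hv hbv ha := h.succ_lt_budget a v hav hv hbv ha.1
  queued v hv := by
    refine h.queued v ?_
    rcases hv with hv | rfl | hv
    exacts [Or.inl hv.1, Or.inl hu, Or.inr hv]
  leaf a v hav hv := by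
    rintro (rfl | ha)
    exacts [hv (hleaf v hav), h.leaf a v hav hv ha]
  extended a v hav ha hbud hv := by
    have := h.extended a v hav ha hbud hv
    by_cases hau : a = u <;> simp_all
  target_queued ht := by
    have := h.target_queued ht
    by_cases hau : G.target = u <;> simp_all

theorem updateStep_eq_propagate (h : G.IsBand α par dist bud s) (hG : G.IsFreeTree par dist)
    (hb : G.IsBudget bud) (R : PopRule V) {t : TreeNode V}
    (hu : R.pick s.qUpdate (fun x => nodeKey (s.tree x)) = u) (ht : s.tree u = some t)
    (huv : G.adj u v) (hv : s.tree v ≠ none) :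
    G.updateStep R α s = G.propagate α bud s u t := by
  have hchild : ∃ v, s.IsChild u v := ⟨v, (h.isChild_iff hG).2 ⟨huv, hv⟩⟩
  have hch : {x | ∃ t', s.tree x = some t' ∧ t'.parent = some u ∧ 0 < t'.b ∧ x ∉ s.toRewire} =
      G.lazyChildren bud u := by
    ext x
    constructor
    · rintro ⟨t', ht', hp, hpos, -⟩
      obtain ⟨hux, hx⟩ := (h.isChild_iff hG).1 ⟨t', ht', hp⟩
      exact ⟨hux, (h.budget_pos_iff hG hb hx).1 (hpos.trans_eq (budget_of_eq_some ht').symm)⟩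
    · rintro ⟨hux, hbx⟩
      have hx := h.sibling_mem u v x huv hux hv
      obtain ⟨t', ht', hp⟩ := (h.isChild_iff hG).2 ⟨hux, hx⟩
      have hpos := (h.budget_pos_iff hG hb hx).2 hbx
      rw [budget_of_eq_some ht'] at hpos
      exact ⟨t', ht', hp, hpos, h.toRewire_eq ▸ Set.notMem_empty x⟩
  have hcut : {x | x ∈ G.lazyChildren bud u ∧ ∃ t', s.tree x = some t' ∧ t'.b = α} =
      {x | x ∈ G.lazyChildren bud u ∧ budget s.tree x = α} := by
    ext x
    refine and_congr_right fun hx => ?_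
    obtain ⟨t', ht'⟩ := Option.ne_none_iff_exists'.1 (h.sibling_mem u v x huv hx.1 hv)
    simp [ht', budget_of_eq_some ht']
  subst hu
  rw [LazyProblem.propagate, ← hcut, ← hch]
  simp only [updateStep, ht, if_pos hchild]
  congr 1
  exact ite_eq_overwrite

variable {t : TreeNode V}

theorem tree_propagate_ne_none_iff (h : G.IsBand α par dist bud s) (huv : G.adj u v)
    (hv : s.tree v ≠ none) : (G.propagate α bud s u t).tree x ≠ none ↔ s.tree x ≠ none :=
  overwrite_ne_none_iff_of_subset fun y hy => h.sibling_mem u v y huv hy.1 hv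

theorem budget_propagate_of_notMem (hx : x ∉ G.lazyChildren bud u) :
    budget (G.propagate α bud s u t).tree x = budget s.tree x :=
  budget_overwrite_of_notMem hx

theorem budget_propagate_lt (h : G.IsBand α par dist bud s) (hu : u ∈ s.qUpdate)
    (ht : s.tree u = some t) (huv : G.adj u v) (hv : s.tree v ≠ none)
    (hx : x ∈ G.lazyChildren bud u) :
    budget (G.propagate α bud s u t).tree x < budget s.tree x := by
  have hlt := h.succ_lt_budget u x hx.1 (h.sibling_mem u v x huv hx.1 hv) hx.2 hu
  rw [budget_of_eq_some ht] at hlt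
  exact (budget_overwrite_of_mem hx).trans_lt hlt

theorem budget_propagate_le (h : G.IsBand α par dist bud s) (hu : u ∈ s.qUpdate)
    (ht : s.tree u = some t) (huv : G.adj u v) (hv : s.tree v ≠ none) (x : V) :
    budget (G.propagate α bud s u t).tree x ≤ budget s.tree x := by
  by_cases hx : x ∈ G.lazyChildren bud u
  · exact (h.budget_propagate_lt hu ht huv hv hx).le
  · exact (budget_propagate_of_notMem hx).le

theorem isSearchTree_overwrite_lazyChildren (h : G.IsBand α par dist bud s)
    (hG : G.IsFreeTree par dist) (ht : s.tree u = some t) :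
    IsSearchTree G par dist (overwrite s.tree (G.lazyChildren bud u) (G.childNode u t)) := by
  refine h.toIsSearchTree.overwrite (fun x hx => ⟨u, hx.1, by simp [ht]⟩)
    (fun hx => ((hG.adj_iff _ _).1 hx.1).1 rfl)
    (fun x hx => congrArg some ((hG.adj_iff _ _).1 hx.1).2) (fun x hx => ?_) hG
  rw [hG.dist_eq_add u x hx.1, ← h.key_eq u t ht, childNode, add_assoc]

theorem budget_eq_succ_propagate (h : G.IsBand α par dist bud s) (hG : G.IsFreeTree par dist)
    (ht : s.tree u = some t) {a : V} (hax : G.adj a x) (hx : s.tree x ≠ none) (hbx : bud x ≠ 0)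
    (ha : a ∉ (G.propagate α bud s u t).qUpdate) :
    budget (G.propagate α bud s u t).tree x = budget (G.propagate α bud s u t).tree a + 1 := by
  have ha' : a ∉ G.lazyChildren bud u := fun ha' => ha (Or.inr ha')
  rw [budget_propagate_of_notMem ha']
  by_cases hau : a = u
  · subst hau
    rw [budget_of_eq_some ht]
    exact budget_overwrite_of_mem ⟨hax, hbx⟩
  · rw [budget_propagate_of_notMem fun hx' => hau (hG.eq_of_adj hax hx'.1)]
    exact h.budget_eq_succ a x hax hx hbx fun ha' => ha (Or.inl ⟨ha', hau⟩)

theorem succ_lt_budget_propagate (h : G.IsBand α par dist bud s) (hG : G.IsFreeTree par dist)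
    (hu : u ∈ s.qUpdate) (ht : s.tree u = some t) (huv : G.adj u v) (hv : s.tree v ≠ none)
    {a : V} (hax : G.adj a x) (hx : s.tree x ≠ none) (hbx : bud x ≠ 0)
    (ha : a ∈ (G.propagate α bud s u t).qUpdate) :
    budget (G.propagate α bud s u t).tree a + 1 < budget (G.propagate α bud s u t).tree x := by
  have hau : a ≠ u := by
    rintro rfl
    exact ha.elim (fun ha => ha.2 rfl) fun ha => (hG.dist_lt ha.1).false
  rw [budget_propagate_of_notMem (x := x) fun hx' => hau (hG.eq_of_adj hax hx'.1)]
  rcases ha with ha | ha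
  · exact (Nat.succ_le_succ (h.budget_propagate_le hu ht huv hv a)).trans_lt
      (h.succ_lt_budget a x hax hx hbx ha.1)
  · exact (Nat.succ_lt_succ (h.budget_propagate_lt hu ht huv hv ha)).trans_le
      (h.succ_le_budget hax hx hbx)

theorem mem_frontier_propagate (h : G.IsBand α par dist bud s) (hG : G.IsFreeTree par dist)
    (hb : G.IsBudget bud) (hu : u ∈ s.qUpdate) (hx : s.tree x ≠ none) (hbx : bud x = α) :
    x ∈ (G.propagate α bud s u t).qFrontier := by
  refine ⟨h.mem_frontier x hx hbx, fun hx' => ?_⟩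
  have hux := hx'.1.1
  have hbu := hb.eq_succ u x hux hx'.1.2
  have hlt := h.succ_lt_budget u x hux hx hx'.1.2 hu
  have hle := h.bud_le_budget hG hb (h.mem_of_adj u x hux hx)
  have := h.budget_le x
  omega

theorem propagate (h : G.IsBand α par dist bud s) (hG : G.IsFreeTree par dist)
    (hb : G.IsBudget bud) (hu : u ∈ s.qUpdate) (ht : s.tree u = some t) (huv : G.adj u v)
    (hv : s.tree v ≠ none) : G.IsBand α par dist bud (G.propagate α bud s u t) :=
  have hle := h.budget_propagate_le hu ht huv hv
  have hmem : ∀ x, (G.propagate α bud s u t).tree x ≠ none ↔ s.tree x ≠ none := fun _ =>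
    h.tree_propagate_ne_none_iff huv hv
  { h with
    toIsSearchTree := h.isSearchTree_overwrite_lazyChildren hG ht
    head x hx := by
      have hx' : x ∉ G.lazyChildren bud u := fun hx' => hx'.2 hx
      simpa only [LazyProblem.propagate, overwrite_of_notMem hx'] using h.head x hx
    sibling_mem := by simpa only [hmem] using h.sibling_mem
    budget_le x := (hle x).trans (h.budget_le x)
    budget_eq_succ a x hax hx := h.budget_eq_succ_propagate hG ht hax ((hmem x).1 hx)
    succ_lt_budget a x hax hx :=
      h.succ_lt_budget_propagate hG hu ht huv hv hax ((hmem x).1 hx)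
    queued x hx := by
      rw [hmem]
      rcases hx with (hx | hx) | hx
      · exact (h.queued x (Or.inl hx.1)).imp_right (hle x).trans_lt
      · exact ⟨h.sibling_mem u v x huv hx.1 hv,
          (h.budget_propagate_lt hu ht huv hv hx).trans_le (h.budget_le x)⟩
      · exact (h.queued x (Or.inr hx)).imp_right (hle x).trans_lt
    leaf a x hax hx := h.leaf a x hax ((hmem x).1 hx)
    extended a x hax ha hbud hx := by
      replace hx : s.tree x = none := not_not.1 fun hx' => (hmem x).2 hx' hx
      by_cases ha' : a ∈ G.lazyChildren bud u
      · exact Or.inl (Or.inr ha')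
      rw [budget_propagate_of_notMem ha'] at hbud
      refine (h.extended a x hax ((hmem a).1 ha) hbud hx).imp_left fun haq => Or.inl ⟨haq, ?_⟩
      rintro rfl
      exact h.sibling_mem a v x huv hax hv hx
    frontier := by
      rintro x ⟨hx, hx'⟩
      refine ⟨(hmem x).2 (h.frontier x hx).1, (h.frontier x hx).2.imp_left fun hα => ?_⟩
      rw [budget_propagate_of_notMem fun hch => hx' ⟨hch, hα⟩, hα]
    mem_frontier x hx := h.mem_frontier_propagate hG hb hu ((hmem x).1 hx)
    target_queued ht := by
      by_cases hch : G.target ∈ G.lazyChildren bud u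
      · exact Or.inr (Or.inl (Or.inr hch))
      refine (h.target_queued ((hmem _).1 ht)).imp (fun hq => ⟨hq, fun hx => hch hx.1⟩)
        (Or.imp_left fun hq => Or.inl ⟨hq, ?_⟩)
      rintro rfl
      exact hG.not_adj_target v huv }

end IsBand

/-- The vertices whose budget may still change while the vertices of `Q` are propagated, as this
happens in the order of increasing `dist`. -/
def pending (dist : V → ℝ) (Q : Set V) : Set V :=
  {v | v ∈ Q ∨ ∃ q ∈ Q, dist q < dist v}

theorem pending_ssubset {Q Q' : Set V} (hu : u ∈ Q) (hmin : ∀ q ∈ Q, dist u ≤ dist q)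
    (hQ' : ∀ q ∈ Q', q ∈ Q \ {u} ∨ dist u < dist q) : pending dist Q' ⊂ pending dist Q := by
  refine (Set.ssubset_iff_of_subset ?_).2 ⟨u, Or.inl hu, ?_⟩
  · rintro v (hv | ⟨q, hq, hqv⟩)
    · exact (hQ' v hv).imp (fun h => h.1) fun h => ⟨u, hu, h⟩
    · rcases hQ' q hq with h | h
      exacts [Or.inr ⟨q, h.1, hqv⟩, Or.inr ⟨u, hu, h.trans hqv⟩]
  · rintro (hu' | ⟨q, hq, hqu⟩)
    · exact (hQ' u hu').elim (fun h => h.2 rfl) (lt_irrefl _)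
    · exact (hQ' q hq).elim (fun h => (hmin q h.1).not_gt hqu) hqu.not_gt

theorem IsBand.updateStep (h : G.IsBand α par dist bud s) (hG : G.IsFreeTree par dist)
    (hb : G.IsBudget bud) (R : PopRule V) (hne : s.qUpdate.Nonempty) :
    G.IsBand α par dist bud (G.updateStep R α s) ∧
      pending dist (G.updateStep R α s).qUpdate ⊂ pending dist s.qUpdate := by
  set u := R.pick s.qUpdate fun x => nodeKey (s.tree x) with hu
  have hmem : u ∈ s.qUpdate := R.pick_mem _ _ hne
  have hut := (h.queued u (Or.inl hmem)).1
  have hmin : ∀ q ∈ s.qUpdate, dist u ≤ dist q := fun q hq => by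
    have hle := R.pick_le s.qUpdate (fun x => nodeKey (s.tree x)) q hq
    rw [← hu, h.nodeKey_eq hut, h.nodeKey_eq (h.queued q (Or.inl hq)).1] at hle
    exact WithTop.coe_le_coe.1 hle
  by_cases hleaf : ∀ v, G.adj u v → s.tree v = none
  · rw [h.updateStep_of_forall_tree_eq_none hG R hu.symm hut hleaf]
    exact ⟨h.moveToExtend hmem hleaf, pending_ssubset hmem hmin fun q hq => Or.inl hq⟩
  · push Not at hleaf
    obtain ⟨v, huv, hv⟩ := hleaf
    obtain ⟨t, ht⟩ := Option.ne_none_iff_exists'.1 hut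
    rw [h.updateStep_eq_propagate hG hb R hu.symm ht huv hv]
    exact ⟨h.propagate hG hb hmem ht huv hv,
      pending_ssubset hmem hmin fun q hq => hq.imp_right fun hq => hG.dist_lt hq.1⟩

/-- The state `s` after the vertex `u` with node `t`, a leaf of the tree, has been extended. -/
noncomputable def grow (G : LazyProblem V) (α : ℕ) (bud : V → ℕ) (s : LRAState V) (u : V)
    (t : TreeNode V) : LRAState V :=
  { s with
    tree := overwrite s.tree (G.lazyChildren bud u) (G.childNode u t)
    qFrontier := s.qFrontier ∪ {v | v ∈ G.lazyChildren bud u ∧ t.b + 1 = α}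
    qExtend := (s.qExtend \ {u}) ∪ {v | v ∈ G.lazyChildren bud u ∧ t.b + 1 ≠ α} }

namespace IsBand

variable {t : TreeNode V}

theorem tree_eq_none_of_mem_qExtend (h : G.IsBand α par dist bud s) (hu : u ∈ s.qExtend)
    (huv : G.adj u v) : s.tree v = none :=
  not_not.1 fun hv => h.leaf u v huv hv hu

theorem mem_lazyChildren_of_mem_qExtend (h : G.IsBand α par dist bud s) (hu : u ∈ s.qExtend)
    (huv : G.adj u v) : v ∈ G.lazyChildren bud u := by
  refine ⟨huv, fun h0 => ?_⟩
  obtain ⟨p, hp⟩ := h.head v h0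
  exact Option.some_ne_none _ (hp.symm.trans (h.tree_eq_none_of_mem_qExtend hu huv))

theorem extendStep_eq_grow (h : G.IsBand α par dist bud s) (hG : G.IsFreeTree par dist)
    (R : PopRule V) (hu : R.pick s.qExtend (fun x => nodeKey (s.tree x)) = u)
    (hmem : u ∈ s.qExtend) (ht : s.tree u = some t) (hut : u ≠ G.target) :
    G.extendStep R α s = G.grow α bud s u t := by
  let cut : Set V := {x | ∃ v, s.edges u v ∧
    nodeKey (some (G.childNode u t v)) ≤ nodeKey (s.tree v) ∧ x ∈ s.subtree v}
  have hcut : cut = ∅ := by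
    refine Set.eq_empty_of_forall_notMem ?_
    rintro x ⟨v, huv, -, hx⟩
    rw [h.edges_eq] at huv
    rwa [h.subtree_eq_empty hG (h.tree_eq_none_of_mem_qExtend hmem huv)] at hx
  let new : Set V := {v | s.edges u v ∧ (v ∈ cut ∨ s.tree v = none)}
  have hnew : new = G.lazyChildren bud u := by
    ext v
    change s.edges u v ∧ (v ∈ cut ∨ s.tree v = none) ↔ _
    rw [h.edges_eq]
    exact ⟨fun hv => h.mem_lazyChildren_of_mem_qExtend hmem hv.1,
      fun hv => ⟨hv.1, Or.inr (h.tree_eq_none_of_mem_qExtend hmem hv.1)⟩⟩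
  subst hu
  rw [LazyProblem.grow, ← hnew]
  simp only [extendStep, ht, if_neg hut]
  congr 1
  · funext x
    by_cases hx : x ∈ new
    · exact (if_pos hx).trans (overwrite_of_mem hx).symm
    · have hxcut : x ∉ cut := hcut ▸ Set.notMem_empty x
      exact ((if_neg hx).trans (if_neg hxcut)).trans (overwrite_of_notMem hx).symm
  · exact congrArg (· ∪ _) ((congrArg _ hcut).trans Set.sdiff_empty)
  · exact congrArg (· ∪ _) ((congrArg _ hcut).trans Set.sdiff_empty)

theorem budget_grow_of_tree_ne_none (h : G.IsBand α par dist bud s) (hu : u ∈ s.qExtend)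
    (hx : s.tree x ≠ none) : budget (G.grow α bud s u t).tree x = budget s.tree x :=
  budget_overwrite_of_notMem fun hx' => hx (h.tree_eq_none_of_mem_qExtend hu hx'.1)

theorem budget_grow_of_mem (hx : x ∈ G.lazyChildren bud u) :
    budget (G.grow α bud s u t).tree x = t.b + 1 :=
  budget_overwrite_of_mem hx

theorem tree_grow_ne_none_iff :
    (G.grow α bud s u t).tree x ≠ none ↔ x ∈ G.lazyChildren bud u ∨ s.tree x ≠ none :=
  overwrite_ne_none_iff

theorem sibling_mem_grow (h : G.IsBand α par dist bud s) (hG : G.IsFreeTree par dist)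
    (hu : u ∈ s.qExtend) {a v' : V} (hav : G.adj a v) (hav' : G.adj a v')
    (hv : (G.grow α bud s u t).tree v ≠ none) : (G.grow α bud s u t).tree v' ≠ none := by
  refine tree_grow_ne_none_iff.2 ((tree_grow_ne_none_iff.1 hv).imp (fun hv => ?_)
    (h.sibling_mem a v v' hav hav'))
  exact h.mem_lazyChildren_of_mem_qExtend hu (hG.eq_of_adj hav hv.1 ▸ hav')

theorem budget_eq_succ_grow (h : G.IsBand α par dist bud s) (hG : G.IsFreeTree par dist)
    (hQ : s.qUpdate = ∅) (hu : u ∈ s.qExtend) (ht : s.tree u = some t) {a : V} (hax : G.adj a x)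
    (hx : (G.grow α bud s u t).tree x ≠ none) (hbx : bud x ≠ 0) :
    budget (G.grow α bud s u t).tree x = budget (G.grow α bud s u t).tree a + 1 := by
  rcases tree_grow_ne_none_iff.1 hx with hx | hx
  · rw [budget_grow_of_mem hx, hG.eq_of_adj hax hx.1,
      h.budget_grow_of_tree_ne_none hu (by simp [ht]), budget_of_eq_some ht]
  · rw [h.budget_grow_of_tree_ne_none hu hx,
      h.budget_grow_of_tree_ne_none hu (h.mem_of_adj a x hax hx),
      h.budget_eq_succ a x hax hx hbx (hQ ▸ Set.notMem_empty a)]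

theorem notMem_qExtend_grow (h : G.IsBand α par dist bud s) (hG : G.IsFreeTree par dist)
    (hu : u ∈ s.qExtend) {a : V} (hax : G.adj a x)
    (hx : (G.grow α bud s u t).tree x ≠ none) : a ∉ (G.grow α bud s u t).qExtend := by
  intro ha
  rcases tree_grow_ne_none_iff.1 hx with hx | hx
  · rw [hG.eq_of_adj hax hx.1] at ha
    exact ha.elim (fun ha => ha.2 rfl) fun ha => (hG.dist_lt ha.1.1).false
  · exact ha.elim (fun ha => h.leaf a x hax hx ha.1) fun ha =>
      h.mem_of_adj a x hax hx (h.tree_eq_none_of_mem_qExtend hu ha.1.1)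

theorem extended_grow (h : G.IsBand α par dist bud s) (hu : u ∈ s.qExtend) {a : V}
    (hax : G.adj a x) (ha : (G.grow α bud s u t).tree a ≠ none)
    (hbud : budget (G.grow α bud s u t).tree a < α) (hx : (G.grow α bud s u t).tree x = none) :
    a ∈ s.qUpdate ∪ (G.grow α bud s u t).qExtend := by
  obtain ⟨hxu, hx⟩ := not_or.1 fun hx' => tree_grow_ne_none_iff.2 hx' hx
  rcases tree_grow_ne_none_iff.1 ha with ha | ha
  · rw [budget_grow_of_mem ha] at hbud
    exact Or.inr (Or.inr ⟨ha, hbud.ne⟩)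
  · rw [h.budget_grow_of_tree_ne_none hu ha] at hbud
    refine (h.extended a x hax ha hbud (not_not.1 hx)).imp_right fun haq => Or.inl ⟨haq, ?_⟩
    rintro rfl
    exact hxu (h.mem_lazyChildren_of_mem_qExtend hu hax)

theorem mem_frontier_grow (h : G.IsBand α par dist bud s) (hG : G.IsFreeTree par dist)
    (hb : G.IsBudget bud) (ht : s.tree u = some t) (htb : t.b < α)
    (hx : (G.grow α bud s u t).tree x ≠ none) (hbx : bud x = α) :
    x ∈ (G.grow α bud s u t).qFrontier := by
  rcases tree_grow_ne_none_iff.1 hx with hx | hx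
  · have hsucc := hb.eq_succ u x hx.1 hx.2
    have hle := h.bud_le_budget hG hb (v := u) (by simp [ht])
    rw [budget_of_eq_some ht] at hle
    exact Or.inr ⟨hx, by omega⟩
  · exact Or.inl (h.mem_frontier x hx hbx)

theorem grow (h : G.IsBand α par dist bud s) (hG : G.IsFreeTree par dist)
    (hb : G.IsBudget bud) (hQ : s.qUpdate = ∅) (hu : u ∈ s.qExtend) (hut : u ≠ G.target)
    (ht : s.tree u = some t) : G.IsBand α par dist bud (G.grow α bud s u t) :=
  have hold {x} (hx : s.tree x ≠ none) : budget (G.grow α bud s u t).tree x = budget s.tree x :=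
    h.budget_grow_of_tree_ne_none hu hx
  have htb : t.b < α := (budget_of_eq_some ht).symm.trans_lt (h.queued u (Or.inr hu)).2
  { h with
    toIsSearchTree := h.isSearchTree_overwrite_lazyChildren hG ht
    head x hx := by
      have hx' : x ∉ G.lazyChildren bud u := fun hx' => hx'.2 hx
      simpa only [LazyProblem.grow, overwrite_of_notMem hx'] using h.head x hx
    sibling_mem _ _ _ := h.sibling_mem_grow hG hu
    budget_le x := by
      by_cases hx : x ∈ G.lazyChildren bud u
      · exact (budget_grow_of_mem hx).trans_le htb
      · exact (budget_overwrite_of_notMem hx).trans_le (h.budget_le x)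
    budget_eq_succ _ _ hax hx hbx _ := h.budget_eq_succ_grow hG hQ hu ht hax hx hbx
    succ_lt_budget a _ _ _ _ ha := absurd ha (hQ ▸ Set.notMem_empty a)
    queued := by
      rintro x (hx | ⟨hx, -⟩ | ⟨hx, hb⟩)
      · exact absurd hx (hQ ▸ Set.notMem_empty x)
      · have hx := h.queued x (Or.inr hx)
        exact ⟨tree_grow_ne_none_iff.2 (Or.inr hx.1), (hold hx.1).trans_lt hx.2⟩
      · exact ⟨tree_grow_ne_none_iff.2 (Or.inl hx),
          (budget_grow_of_mem hx).trans_lt (lt_of_le_of_ne htb hb)⟩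
    leaf _ _ := h.notMem_qExtend_grow hG hu
    extended _ _ := h.extended_grow hu
    frontier := by
      rintro x (hx | hx)
      · have hx := h.frontier x hx
        exact ⟨tree_grow_ne_none_iff.2 (Or.inr hx.1), hx.2.imp_left (hold hx.1).trans⟩
      · exact ⟨tree_grow_ne_none_iff.2 (Or.inl hx.1),
          Or.inl ((budget_grow_of_mem hx.1).trans hx.2)⟩
    mem_frontier _ := h.mem_frontier_grow hG hb ht htb
    target_queued hx := by
      rcases tree_grow_ne_none_iff.1 hx with hx | hx
      · by_cases hb : t.b + 1 = α
        exacts [Or.inl (Or.inr ⟨hx, hb⟩), Or.inr (Or.inr (Or.inr ⟨hx, hb⟩))]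
      · exact (h.target_queued hx).imp Or.inl
          (Or.imp_right fun hq => Or.inl ⟨hq, hut.symm⟩) }

theorem extendStep_of_eq_target (R : PopRule V)
    (hu : R.pick s.qExtend (fun x => nodeKey (s.tree x)) = G.target)
    (ht : s.tree G.target = some t) :
    G.extendStep R α s =
      { s with
        qExtend := s.qExtend \ {G.target}
        qFrontier := insert G.target s.qFrontier } := by
  simp only [extendStep, hu, ht, if_true]

theorem moveToFrontier (h : G.IsBand α par dist bud s) (hG : G.IsFreeTree par dist)
    (ht : G.target ∈ s.qExtend) :
    G.IsBand α par dist bud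
      { s with
        qExtend := s.qExtend \ {G.target}
        qFrontier := insert G.target s.qFrontier } where
  __ := h
  queued v hv := h.queued v (hv.imp_right fun hv => hv.1)
  leaf a v hav hv ha := h.leaf a v hav hv ha.1
  extended a v hav ha hbud hv := by
    refine (h.extended a v hav ha hbud hv).imp_right fun haq => ⟨haq, ?_⟩
    rintro rfl
    exact hG.not_adj_target v hav
  frontier := by
    rintro v (rfl | hv)
    exacts [⟨(h.queued _ (Or.inr ht)).1, Or.inr rfl⟩, h.frontier v hv]
  mem_frontier v hv hbv := Or.inr (h.mem_frontier v hv hbv)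
  target_queued _ := Or.inl (Or.inl rfl)

end IsBand

theorem IsBand.extendStep (h : G.IsBand α par dist bud s) (hG : G.IsFreeTree par dist)
    (hb : G.IsBudget bud) (R : PopRule V) (hQ : s.qUpdate = ∅) (hne : s.qExtend.Nonempty) :
    (G.IsBand α par dist bud (G.extendStep R α s) ∧ (G.extendStep R α s).qUpdate = ∅) ∧
      {v | (G.extendStep R α s).tree v = none ∨ v ∈ (G.extendStep R α s).qExtend} ⊂
        {v | s.tree v = none ∨ v ∈ s.qExtend} := by
  set u := R.pick s.qExtend fun x => nodeKey (s.tree x) with hu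
  have hmem : u ∈ s.qExtend := R.pick_mem _ _ hne
  have hut := (h.queued u (Or.inr hmem)).1
  obtain ⟨t, ht⟩ := Option.ne_none_iff_exists'.1 hut
  by_cases hutarget : u = G.target
  · rw [extendStep_of_eq_target R (hu.symm.trans hutarget) (hutarget ▸ ht)]
    refine ⟨⟨h.moveToFrontier hG (hutarget ▸ hmem), hQ⟩, ?_⟩
    refine (Set.ssubset_iff_of_subset fun v hv => hv.imp_right fun hv => hv.1).2
      ⟨u, Or.inr hmem, not_or.2 ⟨hut, fun hu' => hu'.2 hutarget⟩⟩
  · rw [h.extendStep_eq_grow hG R hu.symm hmem ht hutarget]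
    have hnew : ∀ v, (G.grow α bud s u t).tree v = none → s.tree v = none := fun v hv =>
      not_not.1 fun hv' => overwrite_ne_none_iff.2 (Or.inr hv') hv
    refine ⟨⟨h.grow hG hb hQ hmem hutarget ht, hQ⟩, (Set.ssubset_iff_of_subset ?_).2
      ⟨u, Or.inr hmem, not_or.2 ⟨fun hu' => hut (hnew u hu'), ?_⟩⟩⟩
    · rintro v (hv | hv | hv)
      exacts [Or.inl (hnew v hv), Or.inr hv.1,
        Or.inl (h.tree_eq_none_of_mem_qExtend hmem hv.1.1)]
    · rintro (hu' | hu')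
      exacts [hu'.2 rfl, (hG.dist_lt hu'.1.1).false]

theorem exists_iterate_of_ssubset [Finite V] {σ : Type*} (f : σ → σ) (P : σ → Prop)
    (Q μ : σ → Set V) (hstep : ∀ s, P s → (Q s).Nonempty → P (f s) ∧ μ (f s) ⊂ μ s) {s : σ}
    (hs : P s) : ∃ n, P (f^[n] s) ∧ Q (f^[n] s) = ∅ := by
  induction hm : (μ s).ncard using Nat.strong_induction_on generalizing s with
  | _ m ih =>
    rcases (Q s).eq_empty_or_nonempty with hQ | hQ
    · exact ⟨0, hs, hQ⟩
    · obtain ⟨hP, hlt⟩ := hstep s hs hQ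
      obtain ⟨n, hn⟩ := ih _ (hm ▸ Set.ncard_lt_ncard hlt) hP rfl
      exact ⟨n + 1, hn⟩

theorem IsBand.exists_isSettled [Finite V] (h : G.IsBand α par dist bud s)
    (hG : G.IsFreeTree par dist) (hb : G.IsBudget bud) (R : PopRule V) (β : ℕ) :
    ∃ n, G.IsSettled α par dist bud ((G.lraStep R α β)^[n] s) := by
  obtain ⟨m, hm, hQm⟩ := exists_iterate_of_ssubset (G.lraStep R α β) (G.IsBand α par dist bud)
    LRAState.qUpdate (fun s => pending dist s.qUpdate) (fun s hs hne => by
      simpa only [lraStep, hs.not_halted, hne, if_true, if_false] using hs.updateStep hG hb R hne) h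
  obtain ⟨n, ⟨hn, hQn⟩, hEn⟩ := exists_iterate_of_ssubset (G.lraStep R α β)
    (fun s => G.IsBand α par dist bud s ∧ s.qUpdate = ∅) LRAState.qExtend
    (fun s => {v | s.tree v = none ∨ v ∈ s.qExtend}) (fun s hs hne => by
      simpa only [lraStep, hs.1.not_halted, hs.2, hs.1.toRewire_eq, hs.1.qRewire_eq, hne,
        Set.not_nonempty_empty, if_true, if_false] using hs.1.extendStep hG hb R hs.2 hne)
    ⟨hm, hQm⟩
  rw [← Function.iterate_add_apply] at hn hQn hEn
  exact ⟨n + m, hn, hQn, hEn⟩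

theorem tree_initState_ne_none_iff : G.initState.tree v ≠ none ↔ v = G.source := by
  simp [initState]

theorem budget_initState : budget G.initState.tree v = 0 := by
  by_cases hv : v = G.source <;> simp [budget, initState, hv]

theorem IsFreeTree.tree_initState_eq_none (hG : G.IsFreeTree par dist) (huv : G.adj u v) :
    G.initState.tree v = none :=
  not_not.1 (mt tree_initState_ne_none_iff.1 ((hG.adj_iff u v).1 huv).1)

theorem isSearchTree_initState (hG : G.IsFreeTree par dist) :
    IsSearchTree G par dist G.initState.tree where
  source := if_pos rfl
  parent_eq v t hv ht := by simp [initState, hv] at ht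
  key_eq v t ht := by
    obtain rfl : v = G.source := tree_initState_ne_none_iff.1 (by simp [ht])
    obtain rfl : (⟨none, 0, 0, 0⟩ : TreeNode V) = t := by simpa [initState] using ht
    simp [hG.dist_source]
  mem_of_adj _ _ huv hv := absurd (hG.tree_initState_eq_none huv) hv

theorem isBand_initState (hG : G.IsFreeTree par dist) (hb : ∀ v, bud v = 0 ↔ v = G.source)
    (hα : 0 < α) : G.IsBand α par dist bud G.initState where
  toIsSearchTree := isSearchTree_initState hG
  not_halted := id
  edges_eq := rfl
  toRewire_eq := rfl
  qRewire_eq := rfl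
  evaluated_eq := by
    refine (Set.eq_empty_of_forall_notMem ?_).symm
    rintro e ⟨he, h0⟩
    exact ((hG.adj_iff _ _).1 he).1 ((hb _).1 h0)
  head v hv := by
    obtain rfl := (hb v).1 hv
    exact ⟨none, hG.dist_source ▸ (isSearchTree_initState hG).source⟩
  sibling_mem _ _ _ huv _ hv := absurd (hG.tree_initState_eq_none huv) hv
  budget_le _ := budget_initState.trans_le hα.le
  budget_eq_succ _ _ huv hv := absurd (hG.tree_initState_eq_none huv) hv
  succ_lt_budget _ _ huv hv := absurd (hG.tree_initState_eq_none huv) hv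
  queued := by
    rintro v (hv | hv)
    exacts [hv.elim, ⟨tree_initState_ne_none_iff.2 hv, budget_initState.trans_lt hα⟩]
  leaf _ _ huv hv := absurd (hG.tree_initState_eq_none huv) hv
  extended _ _ _ hu _ _ := Or.inr (tree_initState_ne_none_iff.1 hu)
  frontier _ hv := hv.elim
  mem_frontier v hv hbv := by
    rw [(hb v).2 (tree_initState_ne_none_iff.1 hv)] at hbv
    exact absurd hbv hα.ne
  target_queued ht := absurd (tree_initState_ne_none_iff.1 ht).symm G.source_ne_target

namespace IsSettled

theorem budget_eq (h : G.IsSettled α par dist bud s) (hG : G.IsFreeTree par dist)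
    (hb : G.IsBudget bud) (hv : s.tree v ≠ none) : budget s.tree v = bud v := by
  induction hn : bud v generalizing v with
  | zero =>
    exact not_ne_iff.1 fun h0 =>
      (h.budget_pos_iff hG hb hv).1 (Nat.pos_of_ne_zero h0) hn
  | succ n ih =>
    have hbv : bud v ≠ 0 := by omega
    have hadj := hb.adj_par hG hbv
    have := hb.eq_succ _ _ hadj hbv
    rw [h.budget_eq_succ _ _ hadj hv hbv (h.qUpdate_eq ▸ Set.notMem_empty _),
      ih (h.mem_of_adj _ _ hadj hv) (by omega)]

theorem tree_ne_none_iff (h : G.IsSettled α par dist bud s) (hG : G.IsFreeTree par dist)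
    (hb : G.IsBudget bud) : s.tree v ≠ none ↔ bud v ≤ α := by
  refine ⟨fun hv => h.budget_eq hG hb hv ▸ h.budget_le v, fun hle => ?_⟩
  induction hn : bud v generalizing v with
  | zero =>
    obtain ⟨p, hp⟩ := h.head v hn
    simp [hp]
  | succ n ih =>
    have hbv : bud v ≠ 0 := by omega
    have hadj := hb.adj_par hG hbv
    have hsucc := hb.eq_succ _ _ hadj hbv
    have hpar : s.tree (par v) ≠ none := ih (by omega) (by omega)
    intro hv
    have hq := h.extended _ _ hadj hpar (by rw [h.budget_eq hG hb hpar]; omega) hv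
    rw [h.qUpdate_eq, h.qExtend_eq, Set.union_empty] at hq
    exact hq

theorem mem_qFrontier_iff (h : G.IsSettled α par dist bud s) (hG : G.IsFreeTree par dist)
    (hb : G.IsBudget bud) :
    v ∈ s.qFrontier ↔ bud v = α ∨ v = G.target ∧ bud v ≤ α := by
  have hmem : ∀ {x}, s.tree x ≠ none ↔ bud x ≤ α := h.tree_ne_none_iff hG hb
  constructor
  · intro hv
    obtain ⟨hvt, hv'⟩ := h.frontier v hv
    rw [h.budget_eq hG hb hvt] at hv'
    exact hv'.imp_right fun hv' => ⟨hv', hmem.1 hvt⟩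
  · rintro (hv | ⟨rfl, hv⟩)
    · exact h.mem_frontier v (hmem.2 hv.le) hv
    · have hq := h.target_queued (hmem.2 hv)
      rwa [h.qUpdate_eq, h.qExtend_eq, Set.union_empty, Set.union_empty] at hq

end IsSettled

/-- The state `s` after the edges into the vertices of `S` have been evaluated. -/
noncomputable def promote (G : LazyProblem V) (par : V → V) (dist : V → ℝ) (S : Set V)
    (s : LRAState V) : LRAState V :=
  { s with
    tree := overwrite s.tree S fun x => ⟨some (par x), dist x, 0, 0⟩
    qUpdate := s.qUpdate ∪ S
    evaluated := s.evaluated ∪ {e | G.adj e.1 e.2 ∧ e.2 ∈ S} }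

theorem promote_empty : G.promote par dist ∅ s = s := by
  have htree : overwrite s.tree ∅ (fun x => ⟨some (par x), dist x, 0, 0⟩) = s.tree :=
    funext fun _ => overwrite_of_notMem (Set.notMem_empty _)
  simp [promote, htree]

theorem promote_promote {S S' : Set V} :
    G.promote par dist S' (G.promote par dist S s) = G.promote par dist (S ∪ S') s := by
  simp only [promote, overwrite_overwrite, Set.union_assoc, Set.mem_union, and_or_left,
    Set.ofPred_or]

theorem evaluatePath_cons_cons (hG : G.IsFreeTree par dist) (huv : G.adj u v)
    (hv : v ≠ G.target) (hc : ((s.tree u).map TreeNode.c).getD 0 = dist u) (n : ℕ) (p : List V) :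
    G.evaluatePath (n + 1) (u :: v :: p) s =
      G.evaluatePath n (v :: p) (G.promote par dist {v} s) := by
  have hset : {e : V × V | G.adj e.1 e.2 ∧ e.2 ∈ ({v} : Set V)} = {(u, v)} := by
    ext ⟨a, b⟩
    constructor
    · rintro ⟨hab, rfl⟩
      exact Prod.ext (hG.eq_of_adj hab huv) rfl
    · rintro ⟨⟩
      exact ⟨huv, rfl⟩
  simp only [evaluatePath, if_pos (hG.w_eq_lazyW u v huv), if_neg hv, promote, hset,
    Set.union_singleton]
  congr 2
  funext x
  by_cases hx : x = v
  · subst hx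
    simp [overwrite, hc, hG.dist_eq_add u x huv, ← ((hG.adj_iff u x).1 huv).2]
  · simp [overwrite, hx]

theorem evaluatePath_eq_promote (hG : G.IsFreeTree par dist) {p : List V}
    (hp : (u :: p).IsChain G.adj) (htarget : G.target ∉ p)
    (hc : ((s.tree u).map TreeNode.c).getD 0 = dist u) (n : ℕ) :
    G.evaluatePath n (u :: p) s = G.promote par dist {x | x ∈ p.take n} s := by
  induction p generalizing u s n with
  | nil => cases n <;> simp [evaluatePath, promote_empty]
  | cons v p ih =>
    cases n with
    | zero => simp [evaluatePath, promote_empty]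
    | succ n =>
      obtain ⟨huv, hp⟩ := List.isChain_cons_cons.1 hp
      obtain ⟨hv, htarget⟩ := not_or.1 (mt List.mem_cons.2 htarget)
      rw [evaluatePath_cons_cons hG huv (Ne.symm hv) hc, ih hp htarget, promote_promote]
      · simp only [List.take_succ_cons, List.mem_cons, Set.ofPred_or, Set.ofPred_eq_eq_singleton]
      · simp [promote, overwrite]

theorem IsSearchTree.tail_eq (h : IsSearchTree G par dist s.tree) (hG : G.IsFreeTree par dist)
    {n : ℕ} (hv : s.tree v ≠ none) (hn : ∀ k < n, par^[k] v ≠ G.source) :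
    s.tail n v = par^[n] v :: (List.iterate par v n).reverse := by
  induction n generalizing v with
  | zero => rfl
  | succ n ih =>
    obtain ⟨t, ht⟩ := Option.ne_none_iff_exists'.1 hv
    have hsource : v ≠ G.source := hn 0 n.succ_pos
    have hpar := h.mem_of_adj _ _ (hG.adj_par hsource) hv
    have htail : s.tail (n + 1) v = s.tail n (par v) ++ [v] := by
      simp [LRAState.tail, ht, h.parent_eq v t hsource ht]
    rw [htail, ih hpar fun k hk => hn (k + 1) (Nat.succ_lt_succ hk)]
    simp [List.iterate]

theorem IsFreeTree.isChain_reverse_iterate (hG : G.IsFreeTree par dist) {n : ℕ}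
    (hn : ∀ k < n, par^[k] v ≠ G.source) :
    (par^[n] v :: (List.iterate par v n).reverse).IsChain G.adj := by
  have hiterate : par^[n] v :: (List.iterate par v n).reverse =
      (List.iterate par v (n + 1)).reverse := by
    rw [List.iterate_add, List.reverse_append]
    rfl
  rw [hiterate, List.isChain_reverse, List.isChain_iff_getElem]
  intro k hk
  rw [List.length_iterate] at hk
  simp only [List.getElem_iterate, Function.iterate_succ_apply']
  exact hG.adj_par (hn k (by omega))

theorem mem_take_reverse_iterate {n : ℕ} :
    x ∈ (List.iterate par v n).reverse.take β ↔ ∃ k < n, n ≤ k + β ∧ par^[k] v = x := by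
  rw [List.take_reverse, List.mem_reverse, List.mem_drop_iff_getElem]
  simp only [List.length_iterate, List.getElem_iterate]
  constructor
  · rintro ⟨j, hj, rfl⟩
    exact ⟨n - β + j, by omega, by omega, rfl⟩
  · rintro ⟨k, hk, hnk, rfl⟩
    exact ⟨k - (n - β), by omega, by rw [Nat.add_sub_cancel' (by omega)]⟩

/-- The ends of the edges that are evaluated when the frontier vertex `v` is chosen: on the path
to `v`, the first `β` vertices of the tail after the border vertex. -/
def tailHead (par : V → V) (bud : V → ℕ) (β : ℕ) (v : V) : Set V :=
  {x | ∃ k < bud v, bud v ≤ k + β ∧ par^[k] v = x}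

theorem bud_ne_zero_of_mem_tailHead (hb : G.IsBudget bud) (hG : G.IsFreeTree par dist)
    (hx : x ∈ tailHead par bud β v) : bud x ≠ 0 := by
  obtain ⟨k, hk, -, rfl⟩ := hx
  rw [hb.iterate_par hG v hk.le]
  omega

theorem eq_or_bud_lt_of_mem_tailHead (hb : G.IsBudget bud) (hG : G.IsFreeTree par dist)
    (hx : x ∈ tailHead par bud β v) : x = v ∨ bud x < bud v := by
  obtain ⟨_ | k, hk, -, rfl⟩ := hx
  · exact Or.inl rfl
  · rw [hb.iterate_par hG v hk.le]
    omega

theorem tree_promote_of_mem {S : Set V} (hx : x ∈ S) :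
    (G.promote par dist S s).tree x = some ⟨some (par x), dist x, 0, 0⟩ :=
  if_pos hx

theorem tree_promote_of_notMem {S : Set V} (hx : x ∉ S) :
    (G.promote par dist S s).tree x = s.tree x :=
  if_neg hx

theorem budget_promote_of_mem {S : Set V} (hx : x ∈ S) :
    budget (G.promote par dist S s).tree x = 0 :=
  budget_overwrite_of_mem hx

theorem budget_promote_of_notMem {S : Set V} (hx : x ∉ S) :
    budget (G.promote par dist S s).tree x = budget s.tree x :=
  budget_overwrite_of_notMem hx

theorem budget_promote_le {S : Set V} :
    budget (G.promote par dist S s).tree x ≤ budget s.tree x := by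
  by_cases hx : x ∈ S
  · exact (budget_promote_of_mem hx).trans_le (Nat.zero_le _)
  · exact (budget_promote_of_notMem hx).le

namespace IsSettled

theorem lraStep_eq_searchStep (h : G.IsSettled α par dist bud s) (R : PopRule V) (β : ℕ)
    (hne : s.qFrontier.Nonempty) : G.lraStep R α β s = G.searchStep R β s := by
  simp [lraStep, h.not_halted, h.qUpdate_eq, h.toRewire_eq, h.qRewire_eq, h.qExtend_eq, hne]

theorem tail_eq (h : G.IsSettled α par dist bud s) (hG : G.IsFreeTree par dist)
    (hb : G.IsBudget bud) (hv : s.tree v ≠ none) :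
    s.tail (budget s.tree v) v = par^[bud v] v :: (List.iterate par v (bud v)).reverse := by
  rw [h.budget_eq hG hb hv]
  exact h.toIsSearchTree.tail_eq hG hv fun k hk => hb.iterate_par_ne_source hG hk

theorem lraStep_eq_promote (h : G.IsSettled α par dist bud s) (hG : G.IsFreeTree par dist)
    (hb : G.IsBudget bud) (R : PopRule V) (β : ℕ) (hv : v ∈ s.qFrontier)
    (hpick : R.pick s.qFrontier (fun x => nodeKey (s.tree x)) = v) (hvt : v ≠ G.target) :
    G.lraStep R α β s = G.promote par dist (tailHead par bud β v)
      { s with qFrontier := s.qFrontier \ {v} } := by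
  have htarget : G.target ∉ (List.iterate par v (bud v)).reverse := by
    rw [List.mem_reverse, List.mem_iterate]
    rintro ⟨_ | k, hk, hkt⟩
    · exact hvt hkt.symm
    · have hadj := hb.adj_par hG (v := par^[k] v) (by rw [hb.iterate_par hG v (by omega)]; omega)
      rw [← Function.iterate_succ_apply' par, ← hkt] at hadj
      exact hG.not_adj_target _ hadj
  obtain ⟨p, hp⟩ := h.head (par^[bud v] v) ((hb.iterate_par hG v le_rfl).trans (Nat.sub_self _))
  rw [h.lraStep_eq_searchStep R β ⟨v, hv⟩]
  simp only [searchStep, hpick]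
  rw [← budget, h.tail_eq hG hb (h.frontier v hv).1,
    evaluatePath_eq_promote hG (hG.isChain_reverse_iterate fun k hk =>
      hb.iterate_par_ne_source hG hk) htarget (by simp [hp])]
  simp only [mem_take_reverse_iterate, tailHead]

theorem tree_ne_none_of_mem_tailHead (h : G.IsSettled α par dist bud s)
    (hG : G.IsFreeTree par dist) (hb : G.IsBudget bud) (hv : s.tree v ≠ none)
    (hx : x ∈ tailHead par bud β v) : s.tree x ≠ none := by
  rw [h.tree_ne_none_iff hG hb] at hv ⊢
  rcases eq_or_bud_lt_of_mem_tailHead hb hG hx with rfl | hlt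
  exacts [hv, hlt.le.trans hv]

theorem isSearchTree_promote (h : G.IsSettled α par dist bud s) (hG : G.IsFreeTree par dist)
    (hb : G.IsBudget bud) (hv : s.tree v ≠ none) :
    IsSearchTree G par dist (G.promote par dist (tailHead par bud β v) s).tree := by
  have hbud {x} (hx : x ∈ tailHead par bud β v) : bud x ≠ 0 :=
    bud_ne_zero_of_mem_tailHead hb hG hx
  refine h.overwrite (fun x hx => ?_) (fun hx => hbud hx hb.source) (fun _ _ => rfl)
    (fun x _ => add_zero _) hG
  have hadj := hb.adj_par hG (hbud hx)
  exact ⟨par x, hadj, h.mem_of_adj _ _ hadj (h.tree_ne_none_of_mem_tailHead hG hb hv hx)⟩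

theorem succ_lt_budget_promote (h : G.IsSettled α par dist bud s) (hG : G.IsFreeTree par dist)
    (hb : G.IsBudget bud) (huv : G.adj u v) (hv : s.tree v ≠ none) (hbv : bud v ≠ 0)
    (hu : u ∈ tailHead par bud β x) (hvx : v ∉ tailHead par bud β x) :
    budget (G.promote par dist (tailHead par bud β x) s).tree u + 1 <
      budget (G.promote par dist (tailHead par bud β x) s).tree v := by
  have hpos := (h.budget_pos_iff hG hb (h.mem_of_adj u v huv hv)).2
    (bud_ne_zero_of_mem_tailHead hb hG hu)
  have hle := h.succ_le_budget huv hv hbv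
  rw [budget_promote_of_mem hu, budget_promote_of_notMem hvx]
  omega

theorem frontier_promote (h : G.IsSettled α par dist bud s) (hG : G.IsFreeTree par dist)
    (hb : G.IsBudget bud) (hv : s.tree v ≠ none) (hx : x ∈ s.qFrontier) (hxv : x ≠ v) :
    budget (G.promote par dist (tailHead par bud β v) s).tree x = α ∨ x = G.target := by
  obtain ⟨hxt, hx'⟩ := h.frontier x hx
  by_cases hxS : x ∈ tailHead par bud β v
  · have hvα := (h.tree_ne_none_iff hG hb).1 hv
    have hlt := (eq_or_bud_lt_of_mem_tailHead hb hG hxS).resolve_left hxv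
    rw [h.budget_eq hG hb hxt] at hx'
    exact Or.inr (hx'.resolve_left (by omega))
  · rwa [budget_promote_of_notMem hxS]

theorem tree_promote_ne_none_iff (h : G.IsSettled α par dist bud s)
    (hG : G.IsFreeTree par dist) (hb : G.IsBudget bud) (hv : s.tree v ≠ none) :
    (G.promote par dist (tailHead par bud β v) s).tree x ≠ none ↔ s.tree x ≠ none := by
  rw [promote, overwrite_ne_none_iff_of_subset fun _ => h.tree_ne_none_of_mem_tailHead hG hb hv]

theorem mem_tailHead_of_tree_eq_none (h : G.IsSettled α par dist bud s)
    (hG : G.IsFreeTree par dist) (hb : G.IsBudget bud) (hv : s.tree v ≠ none) (hux : G.adj u x)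
    (hu : s.tree u ≠ none)
    (hbud : budget (G.promote par dist (tailHead par bud β v) s).tree u < α)
    (hx : (G.promote par dist (tailHead par bud β v) s).tree x = none) :
    u ∈ tailHead par bud β v := by
  by_contra huS
  rw [budget_promote_of_notMem huS] at hbud
  have hx : s.tree x = none :=
    not_not.1 fun hx' => (h.tree_promote_ne_none_iff hG hb hv).2 hx' hx
  have hq := h.extended u x hux hu hbud hx
  rwa [h.qUpdate_eq, h.qExtend_eq, Set.union_empty] at hq

theorem isBand_promote (h : G.IsSettled α par dist bud s) (hG : G.IsFreeTree par dist)
    (hb : G.IsBudget bud) (hb' : G.IsBudget bud') (hv : v ∈ s.qFrontier) (hvt : v ≠ G.target)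
    (hva : bud' v < α) (hbud' : ∀ x, bud' x = 0 ↔ bud x = 0 ∨ x ∈ tailHead par bud β v) :
    G.IsBand α par dist bud' (G.promote par dist (tailHead par bud β v)
      { s with qFrontier := s.qFrontier \ {v} }) :=
  have hvt' := (h.frontier v hv).1
  have hmem {x} : (G.promote par dist (tailHead par bud β v) s).tree x ≠ none ↔ s.tree x ≠ none :=
    h.tree_promote_ne_none_iff hG hb hvt'
  have hlazy {x} (hx : bud' x ≠ 0) : bud x ≠ 0 ∧ x ∉ tailHead par bud β v :=
    not_or.1 (mt (hbud' x).2 hx)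
  have hqUpdate {x} : x ∉ s.qUpdate := h.qUpdate_eq ▸ Set.notMem_empty x
  have hqExtend {x} : x ∉ s.qExtend := h.qExtend_eq ▸ Set.notMem_empty x
  { h with
    toIsSearchTree := h.isSearchTree_promote hG hb hvt'
    evaluated_eq := by
      simp only [promote, h.evaluated_eq, hbud', ← Set.ofPred_or, ← and_or_left]
    head := fun x hx => by
      by_cases hxS : x ∈ tailHead par bud β v
      · exact ⟨_, tree_promote_of_mem hxS⟩
      · rw [tree_promote_of_notMem hxS]
        exact h.head x (((hbud' x).1 hx).resolve_right hxS)
    sibling_mem := fun a b b' hab hab' hbt =>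
      hmem.2 (h.sibling_mem a b b' hab hab' (hmem.1 hbt))
    budget_le := fun x => budget_promote_le.trans (h.budget_le x)
    budget_eq_succ := fun a b hab hbt hb0 ha => by
      rw [budget_promote_of_notMem (hlazy hb0).2, budget_promote_of_notMem (not_or.1 ha).2]
      exact h.budget_eq_succ a b hab (hmem.1 hbt) (hlazy hb0).1 hqUpdate
    succ_lt_budget := fun a b hab hbt hb0 ha =>
      h.succ_lt_budget_promote hG hb hab (hmem.1 hbt) (hlazy hb0).1 (ha.resolve_left hqUpdate)
        (hlazy hb0).2
    queued := fun x hx => by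
      have hxS := (hx.resolve_right hqExtend).resolve_left hqUpdate
      exact ⟨hmem.2 (h.tree_ne_none_of_mem_tailHead hG hb hvt' hxS),
        (budget_promote_of_mem hxS).trans_lt (by omega)⟩
    leaf := fun _ _ _ _ => hqExtend
    extended := fun _ _ hab hat haα hbt =>
      Or.inl (Or.inr (h.mem_tailHead_of_tree_eq_none hG hb hvt' hab (hmem.1 hat) haα hbt))
    frontier := fun x hx =>
      ⟨hmem.2 (h.frontier x hx.1).1, h.frontier_promote hG hb hvt' hx.1 hx.2⟩
    mem_frontier := fun x hxt hx => by
      have hxα := hb.mono hb' hG (fun y hy => (hbud' y).2 (Or.inl hy)) x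
      have hbud := (h.tree_ne_none_iff hG hb).1 (hmem.1 hxt)
      exact ⟨h.mem_frontier x (hmem.1 hxt) (by omega), fun hxv => hva.ne (hxv ▸ hx)⟩
    target_queued := fun ht =>
      Or.inl ⟨(h.target_queued (hmem.1 ht)).resolve_right
        (Or.rec hqUpdate hqExtend), Ne.symm hvt⟩ }

theorem exists_isSettled_of_pick [Finite V] (h : G.IsSettled α par dist bud s)
    (hG : G.IsFreeTree par dist) (hb : G.IsBudget bud) (hb' : G.IsBudget bud') (R : PopRule V)
    (hv : v ∈ s.qFrontier) (hpick : R.pick s.qFrontier (fun x => nodeKey (s.tree x)) = v)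
    (hvt : v ≠ G.target) (hva : bud' v < α)
    (hbud' : ∀ x, bud' x = 0 ↔ bud x = 0 ∨ x ∈ tailHead par bud β v) :
    ∃ n, G.IsSettled α par dist bud' ((G.lraStep R α β)^[n] s) := by
  obtain ⟨n, hn⟩ := (h.isBand_promote hG hb hb' hv hvt hva hbud').exists_isSettled hG hb' R β
  rw [← h.lraStep_eq_promote hG hb R β hv hpick hvt] at hn
  exact ⟨n + 1, hn⟩

theorem halted_lraStep (h : G.IsSettled α par dist bud s) (hG : G.IsFreeTree par dist)
    (hb : G.IsBudget bud) (R : PopRule V) (hβ : 0 < β) (hbud : bud G.target = 1)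
    (htarget : G.target ∈ s.qFrontier)
    (hpick : R.pick s.qFrontier (fun x => nodeKey (s.tree x)) = G.target) :
    (G.lraStep R α β s).halted ∧
      (G.lraStep R α β s).evaluated = insert (par G.target, G.target) s.evaluated := by
  obtain ⟨n, rfl⟩ := Nat.exists_eq_succ_of_ne_zero hβ.ne'
  have hadj := hb.adj_par hG (v := G.target) (by omega)
  rw [h.lraStep_eq_searchStep R _ ⟨_, htarget⟩]
  simp only [searchStep, hpick]
  rw [← budget, h.tail_eq hG hb (h.frontier _ htarget).1, hbud]
  simp [evaluatePath, hG.w_eq_lazyW _ _ hadj, List.iterate]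

end IsSettled

theorem evaluated_subset_evaluatePath (n : ℕ) (p : List V) (s : LRAState V) :
    s.evaluated ⊆ (G.evaluatePath n p s).evaluated := by
  fun_induction evaluatePath G n p s with
  | case1 => exact Set.subset_insert _ _
  | case2 => exact (Set.subset_insert _ _).trans ‹_›
  | case3 => exact Set.subset_insert _ _
  | case4 => exact subset_rfl

theorem evaluated_subset_lraStep (R : PopRule V) (s : LRAState V) :
    s.evaluated ⊆ (G.lraStep R α β s).evaluated := by
  unfold lraStep
  split_ifs
  · rfl
  · simp only [updateStep]
    split
    · rfl
    · split_ifs <;> rfl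
  · rfl
  · simp only [rewireStep]
    split
    · rfl
    · split_ifs <;> rfl
  · simp only [extendStep]
    split
    · rfl
    · split_ifs <;> rfl
  · simp only [searchStep]
    refine subset_trans ?_ (evaluated_subset_evaluatePath ..)
    rfl
  · rfl

theorem monotone_evaluated (R : PopRule V) (s : LRAState V) :
    Monotone fun n => ((G.lraStep R α β)^[n] s).evaluated :=
  monotone_nat_of_le_succ fun n => by
    rw [Function.iterate_succ_apply']
    exact evaluated_subset_lraStep R _

theorem evaluatedEdges_eq_of_halted {R : PopRule V} {n : ℕ}
    (h : ((G.lraStep R α β)^[n] G.initState).halted) :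
    G.evaluatedEdges R α β = ((G.lraStep R α β)^[n] G.initState).evaluated := by
  have hfix : Function.IsFixedPt (G.lraStep R α β) ((G.lraStep R α β)^[n] G.initState) := by
    rw [Function.IsFixedPt, lraStep, if_pos h]
  refine Set.Subset.antisymm ?_ fun e he => ⟨n, he⟩
  rintro e ⟨m, hm⟩
  have hmn := monotone_evaluated R G.initState (Nat.le_add_right m n) hm
  simpa only [Function.iterate_add_apply, (hfix.iterate m).eq] using hmn

theorem IsBand.pick_qFrontier_eq [LinearOrder V] (h : G.IsBand α par dist bud s)
    (hdist : StrictMono dist) (R : PopRule V) (hv : IsLeast s.qFrontier v) :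
    R.pick s.qFrontier (fun x => nodeKey (s.tree x)) = v := by
  set u := R.pick s.qFrontier fun x => nodeKey (s.tree x)
  have hmem : u ∈ s.qFrontier := R.pick_mem _ _ ⟨v, hv.1⟩
  have hle : nodeKey (s.tree u) ≤ nodeKey (s.tree v) :=
    R.pick_le s.qFrontier (fun x => nodeKey (s.tree x)) v hv.1
  rw [h.nodeKey_eq (h.frontier u hmem).1, h.nodeKey_eq (h.frontier v hv.1).1,
    WithTop.coe_le_coe, hdist.le_iff_le] at hle
  exact le_antisymm hle (hv.2 hmem)

theorem eq_of_sum_pow_eq {m : ℕ} (hm : 2 ≤ m) {p q : List ℕ} (hp : p.SortedLT) (hq : q.SortedLT)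
    (h : (p.map (m ^ ·)).sum = (q.map (m ^ ·)).sum) : p = q := by
  rw [← List.sum_toFinset _ hp.nodup, ← List.sum_toFinset _ hq.nodup] at h
  have hset := Finset.geomSum_injective hm h
  exact (List.perm_of_nodup_nodup_toFinset_eq hp.nodup hq.nodup hset).eq_of_sortedLE
    hp.sortedLE hq.sortedLE

/-- The tree on `{0, …, n}` with parent map `par`, all of whose edges are collision-free, the edge
into `v` having weight `2 ^ v`. The source is `0` and the target is `n`. -/
def binaryTree {n : ℕ} (hn : 0 < n) (par : Fin (n + 1) → Fin (n + 1)) :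
    LazyProblem (Fin (n + 1)) where
  adj u v := v ≠ 0 ∧ u = par v
  lazyW _ v := 2 ^ v.val
  w _ v := ((2 ^ v.val : ℝ) : WithTop ℝ)
  source := 0
  target := Fin.last n
  lazyW_pos _ _ _ := by positivity
  w_eq _ _ _ := Or.inl rfl
  source_ne_target h := hn.ne (congrArg Fin.val h)

section binaryTree

variable {n : ℕ} {hn : 0 < n} {par : Fin (n + 1) → Fin (n + 1)} {v : Fin (n + 1)}

/-- The lazy cost of the path from the source to `v` in `binaryTree hn par`. -/
def binaryDist (hpar : ∀ v ≠ 0, par v < v) (v : Fin (n + 1)) : ℝ :=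
  if hv : v = 0 then 0 else binaryDist hpar (par v) + 2 ^ v.val
termination_by v
decreasing_by exact hpar v hv

theorem binaryDist_zero (hpar : ∀ v ≠ 0, par v < v) : binaryDist hpar 0 = 0 := by
  rw [binaryDist, dif_pos rfl]

theorem binaryDist_of_ne_zero (hpar : ∀ v ≠ 0, par v < v) (hv : v ≠ 0) :
    binaryDist hpar v = binaryDist hpar (par v) + 2 ^ v.val := by
  rw [binaryDist, dif_neg hv]

theorem binaryDist_nonneg (hpar : ∀ v ≠ 0, par v < v) (v : Fin (n + 1)) :
    0 ≤ binaryDist hpar v := by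
  induction v using WellFoundedLT.induction with
  | _ v ih =>
    rcases eq_or_ne v 0 with rfl | hv
    · exact (binaryDist_zero hpar).ge
    · rw [binaryDist_of_ne_zero hpar hv]
      exact add_nonneg (ih _ (hpar v hv)) (by positivity)

theorem binaryDist_lt (hpar : ∀ v ≠ 0, par v < v) (v : Fin (n + 1)) :
    binaryDist hpar v < 2 ^ (v.val + 1) := by
  induction v using WellFoundedLT.induction with
  | _ v ih =>
    rcases eq_or_ne v 0 with rfl | hv
    · rw [binaryDist_zero]
      positivity
    · have hpow : (2 : ℝ) ^ ((par v).val + 1) ≤ 2 ^ v.val :=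
        pow_le_pow_right₀ one_le_two (hpar v hv)
      rw [binaryDist_of_ne_zero hpar hv, pow_succ, mul_two]
      exact add_lt_add_left ((ih _ (hpar v hv)).trans_le hpow) _

theorem strictMono_binaryDist (hpar : ∀ v ≠ 0, par v < v) : StrictMono (binaryDist hpar) := by
  intro u v huv
  have hv : v ≠ 0 := (Fin.zero_le u |>.trans_lt huv).ne'
  calc binaryDist hpar u < 2 ^ (u.val + 1) := binaryDist_lt hpar u
    _ ≤ 2 ^ v.val := pow_le_pow_right₀ one_le_two huv
    _ ≤ binaryDist hpar v := by
      rw [binaryDist_of_ne_zero hpar hv]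
      exact le_add_of_nonneg_left (binaryDist_nonneg hpar _)

theorem isFreeTree_binaryTree (hpar : ∀ v ≠ 0, par v < v) :
    (binaryTree hn par).IsFreeTree par (binaryDist hpar) where
  adj_iff _ _ := Iff.rfl
  w_eq_lazyW _ _ _ := rfl
  dist_source := binaryDist_zero hpar
  dist_eq_add := by
    rintro _ v ⟨hv, rfl⟩
    exact binaryDist_of_ne_zero hpar hv
  not_adj_target := by
    rintro v ⟨hv, hlast⟩
    exact ((hpar v hv).trans_le v.le_last).ne hlast.symm

theorem lazyCost_binaryTree_cons (u : Fin (n + 1)) (p : List (Fin (n + 1))) :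
    (binaryTree hn par).lazyCost (u :: p) = (((p.map Fin.val).map (2 ^ ·)).sum : ℕ) := by
  induction p generalizing u with
  | nil => simp [lazyCost]
  | cons v p ih =>
    have hcons : (binaryTree hn par).lazyCost (u :: v :: p) =
        2 ^ v.val + (binaryTree hn par).lazyCost (v :: p) := by
      simp [lazyCost, binaryTree]
    rw [hcons, ih]
    simp

theorem sortedLT_of_isChain_binaryTree (hpar : ∀ v ≠ 0, par v < v) {p : List (Fin (n + 1))}
    (hp : p.IsChain (binaryTree hn par).adj) : (p.map Fin.val).SortedLT := by
  refine List.IsChain.sortedLT ((List.isChain_map _).2 (hp.imp ?_))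
  rintro _ v ⟨hv, rfl⟩
  exact hpar v hv

theorem distinctPathCosts_binaryTree (hpar : ∀ v ≠ 0, par v < v) :
    (binaryTree hn par).DistinctPathCosts := by
  intro p q hp hq hp2 hq2 h
  match p, q with
  | u :: v :: p, u' :: v' :: q =>
    rw [lazyCost_binaryTree_cons, lazyCost_binaryTree_cons, Nat.cast_inj] at h
    have htail := eq_of_sum_pow_eq le_rfl (sortedLT_of_isChain_binaryTree hpar hp.tail)
      (sortedLT_of_isChain_binaryTree hpar hq.tail) h
    obtain ⟨rfl, rfl⟩ := List.cons.inj (List.map_injective_iff.2 Fin.val_injective htail)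
    rw [(isFreeTree_binaryTree hpar).eq_of_adj hp.rel hq.rel]

end binaryTree

/-- The parent map of the fork: a path `0, 1, …, α`, a branch `α + 1, …, 2 * α - 1` that leaves it
at `b + 1`, and the target `2 * α`, which is joined to the source `0`. -/
def forkParent {α b : ℕ} (hb : b < α) (v : Fin (2 * α + 1)) : Fin (2 * α + 1) :=
  ⟨if v.val = 2 * α then 0 else if v.val = α + 1 then b + 1 else v.val - 1, by
    split_ifs <;> omega⟩

/-- The lazy shortest-path problem on the fork, the edge into `v` having weight `2 ^ v`. -/
def fork {α b : ℕ} (hb : b < α) : LazyProblem (Fin (2 * α + 1)) :=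
  binaryTree (Nat.mul_pos two_pos (b.zero_le.trans_lt hb)) (forkParent hb)

/-- The budgets in the fork when the edges into `1, …, β` have been evaluated. -/
def forkBudget (α b β : ℕ) (v : Fin (2 * α + 1)) : ℕ :=
  if v.val = 2 * α then 1
  else if α < v.val then b + 1 + (v.val - α) - min β (b + 1)
  else v.val - β

section fork

variable {b : ℕ} {hb : b < α} {v x : Fin (2 * α + 1)}

theorem val_forkParent (hb : b < α) (v : Fin (2 * α + 1)) : (forkParent hb v).val =
    if v.val = 2 * α then 0 else if v.val = α + 1 then b + 1 else v.val - 1 :=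
  rfl

theorem forkParent_lt (hb : b < α) (v : Fin (2 * α + 1)) (hv : v ≠ 0) : forkParent hb v < v := by
  have hv : v.val ≠ 0 := Fin.val_ne_zero_iff.2 hv
  rw [Fin.lt_def, val_forkParent]
  split_ifs <;> omega

theorem isFreeTree_fork (hb : b < α) :
    (fork hb).IsFreeTree (forkParent hb) (binaryDist (forkParent_lt hb)) :=
  isFreeTree_binaryTree _

theorem forkBudget_eq_zero_iff (hα : 0 < α) (hβ : β ≤ α) :
    forkBudget α b β v = 0 ↔ v.val ≤ β := by
  unfold forkBudget
  split_ifs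
  · exact iff_of_false id (by omega)
  · omega
  · omega

theorem isBudget_fork (hb : b < α) (hβ : β ≤ α) : (fork hb).IsBudget (forkBudget α b β) where
  source := (forkBudget_eq_zero_iff (by omega) hβ).2 (Nat.zero_le β)
  eq_succ := by
    rintro _ v ⟨hv, rfl⟩ hne
    rw [← Fin.val_ne_zero_iff] at hv
    simp only [forkBudget, val_forkParent] at *
    split_ifs at * <;> omega

theorem val_iterate_forkParent {k : ℕ} (hv : v.val < 2 * α) (hk : v.val ≤ α ∨ α + k < v.val) :
    ((forkParent hb)^[k] v).val = v.val - k := by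
  induction k with
  | zero => rfl
  | succ k ih =>
    have ih := ih (by omega)
    rw [Function.iterate_succ_apply', val_forkParent, ih]
    split_ifs <;> omega

theorem mem_tailHead_fork (hv : v.val = α) (hβ : β ≤ α) :
    x ∈ tailHead (forkParent hb) (forkBudget α b 0) β v ↔ 0 < x.val ∧ x.val ≤ β := by
  have hbud : forkBudget α b 0 v = α := by
    unfold forkBudget
    split_ifs <;> omega
  have hval (k : ℕ) : ((forkParent hb)^[k] v).val = α - k := by
    rw [val_iterate_forkParent (by omega) (Or.inl hv.le), hv]
  simp only [tailHead, Set.mem_ofPred_eq, hbud]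
  constructor
  · rintro ⟨k, hk, hkβ, rfl⟩
    rw [hval]
    omega
  · rintro ⟨hx, hxβ⟩
    exact ⟨α - x.val, by omega, by omega, Fin.ext (by rw [hval]; omega)⟩

theorem isLeast_qFrontier_fork {s : LRAState (Fin (2 * α + 1))}
    (h : (fork hb).IsSettled α (forkParent hb) (binaryDist (forkParent_lt hb))
      (forkBudget α b β) s) (hβ : β ≤ α)
    (hv : forkBudget α b β v = α ∨ v = Fin.last _)
    (hmin : ∀ x < v, forkBudget α b β x ≠ α) : IsLeast s.qFrontier v := by
  have hfrontier (x : Fin (2 * α + 1)) :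
      x ∈ s.qFrontier ↔ forkBudget α b β x = α ∨ x = Fin.last _ ∧ forkBudget α b β x ≤ α :=
    h.mem_qFrontier_iff (isFreeTree_fork hb) (isBudget_fork hb hβ)
  have hlast : forkBudget α b β (Fin.last _) ≤ α := by
    rw [forkBudget, if_pos (Fin.val_last _)]
    omega
  constructor
  · exact (hfrontier v).2 (hv.imp_right fun hv => ⟨hv, hv ▸ hlast⟩)
  · intro x hx
    rcases (hfrontier x).1 hx with hx | ⟨rfl, -⟩
    · exact not_lt.1 fun hxv => hmin x hxv hx
    · exact Fin.le_last v

theorem exists_isSettled_fork (hb : b < α) (R : PopRule (Fin (2 * α + 1))) (hβ : 0 < β)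
    (hβα : β ≤ α) :
    ∃ n, (fork hb).IsSettled α (forkParent hb) (binaryDist (forkParent_lt hb))
      (forkBudget α b β) (((fork hb).lraStep R α β)^[n] (fork hb).initState) := by
  have hG := isFreeTree_fork hb
  have hα : 0 < α := hβ.trans_le hβα
  have hstart := isBand_initState (bud := forkBudget α b 0) hG
    (fun v => by
      rw [forkBudget_eq_zero_iff hα hα.le, Nat.le_zero, Fin.val_eq_zero_iff]
      rfl) hα
  obtain ⟨m, hm⟩ := hstart.exists_isSettled hG (isBudget_fork hb hα.le) R β
  have hleast : IsLeast _ (⟨α, by omega⟩ : Fin (2 * α + 1)) :=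
    isLeast_qFrontier_fork hm hα.le
      (Or.inl (by simp only [forkBudget]; split_ifs <;> omega))
      (fun x hx => by
        have hx : x.val < α := hx
        simp only [forkBudget]
        split_ifs <;> omega)
  obtain ⟨n, hn⟩ := hm.exists_isSettled_of_pick hG (isBudget_fork hb hα.le)
    (isBudget_fork hb hβα) R hleast.1
    (hm.pick_qFrontier_eq (strictMono_binaryDist _) R hleast)
    (by
      intro h
      have h : α = 2 * α := congrArg Fin.val h
      omega)
    (by simp only [forkBudget]; split_ifs <;> omega)
    (fun x => by
      rw [mem_tailHead_fork rfl hβα, forkBudget_eq_zero_iff hα hβα,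
        forkBudget_eq_zero_iff hα hα.le]
      omega)
  exact ⟨n + m, by rwa [Function.iterate_add_apply]⟩

theorem mem_evaluatedEdges_fork (hb : b < α) (hb₁ : 1 < b) (R : PopRule (Fin (2 * α + 1)))
    (hx : x.val = α + 1) : (forkParent hb x, x) ∈ (fork hb).evaluatedEdges R α b := by
  have hG := isFreeTree_fork hb
  have hbud := isBudget_fork hb hb.le
  obtain ⟨n, hn⟩ := exists_isSettled_fork hb R (by omega : 0 < b) hb.le
  obtain ⟨v, hv⟩ : ∃ v : Fin (2 * α + 1), v.val = 2 * α - 1 := ⟨⟨2 * α - 1, by omega⟩, rfl⟩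
  have hvα : forkBudget α b b v = α := by
    simp only [forkBudget]
    split_ifs <;> omega
  have hleast : IsLeast _ v := isLeast_qFrontier_fork hn hb.le (Or.inl hvα) fun y hy => by
    rw [Fin.lt_def] at hy
    simp only [forkBudget]
    split_ifs <;> omega
  have hstep := hn.lraStep_eq_promote hG hbud R b hleast.1
    (hn.pick_qFrontier_eq (strictMono_binaryDist _) R hleast)
    (by
      intro h
      have h : v.val = 2 * α := congrArg Fin.val h
      omega)
  have hxv : x ∈ tailHead (forkParent hb) (forkBudget α b b) b v :=
    ⟨α - 2, by rw [hvα]; omega, by rw [hvα]; omega, Fin.ext (by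
      rw [val_iterate_forkParent (by omega) (Or.inr (by omega))]
      omega)⟩
  refine ⟨n + 1, ?_⟩
  rw [Function.iterate_succ_apply', hstep]
  have hx₀ : x ≠ 0 := Fin.val_ne_zero_iff.1 (by omega)
  exact Or.inr ⟨⟨hx₀, rfl⟩, hxv⟩

theorem notMem_evaluatedEdges_fork (hb : b < α) (hbβ : b < β) (hβ : β ≤ α)
    (R : PopRule (Fin (2 * α + 1))) (hαx : α < x.val) (hx : x.val < 2 * α) :
    (forkParent hb x, x) ∉ (fork hb).evaluatedEdges R α β := by
  have hG := isFreeTree_fork hb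
  have hbud := isBudget_fork hb hβ
  have hβ₀ : 0 < β := b.zero_le.trans_lt hbβ
  obtain ⟨n, hn⟩ := exists_isSettled_fork hb R hβ₀ hβ
  have hleast : IsLeast _ (fork hb).target :=
    isLeast_qFrontier_fork hn hβ (Or.inr rfl) fun y _ => by
      simp only [forkBudget]
      split_ifs <;> omega
  obtain ⟨hhalt, heval⟩ := hn.halted_lraStep hG hbud R hβ₀
    (if_pos (Fin.val_last _)) hleast.1
    (hn.pick_qFrontier_eq (strictMono_binaryDist _) R hleast)
  rw [← Function.iterate_succ_apply' ((fork hb).lraStep R α β)] at hhalt heval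
  rw [evaluatedEdges_eq_of_halted hhalt, heval, hn.evaluated_eq]
  rintro (h | ⟨-, h⟩)
  · have h : x.val = 2 * α := congrArg (fun e => e.2.val) h
    omega
  · exact hαx.not_ge (((forkBudget_eq_zero_iff (by omega) hβ).1 h).trans hβ)

end fork

end LazyProblem

theorem mainTheorem9 (α β₁ β₂ : ℕ) (h₁ : 1 < β₁) (h₁₂ : β₁ < β₂) (h₂ : β₂ ≤ α) :
    ∃ (V : Type) (_ : Finite V) (G : LazyProblem V), G.DistinctPathCosts ∧
      ∀ R : PopRule V, (G.evaluatedEdges R α β₁ \ G.evaluatedEdges R α β₂).Nonempty := by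
  have hb : β₁ < α := h₁₂.trans_le h₂
  let x : Fin (2 * α + 1) := ⟨α + 1, by omega⟩
  have hx : x.val < 2 * α := show α + 1 < 2 * α by omega
  exact ⟨Fin (2 * α + 1), inferInstance, LazyProblem.fork hb,
    LazyProblem.distinctPathCosts_binaryTree (LazyProblem.forkParent_lt hb),
    fun R => ⟨(LazyProblem.forkParent hb x, x),
      LazyProblem.mem_evaluatedEdges_fork hb h₁ R rfl,
      LazyProblem.notMem_evaluatedEdges_fork hb h₁₂ h₂ R (Nat.lt_succ_self α) hx⟩⟩
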